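/- Let $A\in\mathbb R^{p\times p}$, $B\in\mathbb R^{p\times m}$, $K\in\mathbb R^{m\times p}$, and consider the nominal model $\overline x_{n+1}=A\overline x_n+B\overline u_n+d_n$ with $d_n\in\mathcal W$, with state and input constraint sets $\mathcal X\subseteq\mathbb R^p$ and $\mathcal U\subseteq\mathbb R^m$. Here $\mathcal X,\mathcal U,\mathcal W$ are (bounded) polytopes and $0$ is an interior point of $\mathcal W$. Let $\Lambda\in\mathbb R^{p\times m}$, $\Psi\in\mathbb R^{m\times m}$ parametrize the steady states of the undisturbed model: $\operatorname{range}\begin{bmatrix}\Lambda\\ \Psi\end{bmatrix}=\operatorname{null}\begin{bmatrix}I-A & -B\end{bmatrix}$. Let $\Omega\subseteq\mathbb R^p\times\mathbb R^m$ be a closed convex set such that (a) every $(x,\theta)\in\Omega$ satisfies $x\in\mathcal X$, $\Lambda\theta\in\mathcal X$, $Kx+(\Psi-K\Lambda)\theta\in\mathcal U$ and $\Psi\theta\in\mathcal U$; (b) $\begin{bmatrix}A+BK & B(\Psi-K\Lambda)\\ 0&I\end{bmatrix}\Omega\oplus(\mathcal W\times\{0\})\subseteq\Omega$. Write $S\ominus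 T=\{x : x+t\in S\ \text{for all } t\in T\}$, $\mathcal R_0=\{0\}$, $\mathcal R_i=\bigoplus_{j=0}^{i-1}(A+BK)^j\mathcal W$, and $\|v\|_M^2=v'Mv$. Let $P,Q,R,T$ be symmetric positive definite matrices and $N\ge 1$. For fixed $\overline x_s$, linear MPC at the state $x$ is the problem of minimizing over $c=(c_0,\dots,c_{N-1})$ and $\theta\in\mathbb R^m$ the cost $$\|\overline x_N-\Lambda\theta\|_P^2+\|\overline x_s-\Lambda\theta\|_T^2+\sum_{i=0}^{N-1}\left(\|\overline x_i-\Lambda\theta\|_Q^2+\|\check u_i-\Psi\theta\|_R^2\right)$$ subject to $\overline x_0=x$ and, for $i=0,\dots,N-1$, $$\check u_i=K\overline x_i+c_i,\quad \overline x_{i+1}=A\overline x_i+B\check u_i,\quad \overline x_{i+1}\in\mathcal X\ominus\mathcal R_i,\quad \check u_i\in\mathcal U\ominus K\mathcal R_i,\quad (\overline x_N,\theta)\in\Omega\ominus(\mathcal R_N\times\{0\}).$$ Let $\mathcal X_F$ be the set of $x$ for which this problem is feasible. The control law at $x\in\mathcal X_F$ is $u=Kx+c_0^*$, where $(c^*,\theta^*)$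 is a minimizer. Assume that the target is trackable: $\overline x_s=\Lambda\theta_s$ for some $\theta_s$ with $\Lambda\theta_s\in\mathcal X$ and $(x,\theta_s)\in\Omega$ for some $x$. If $A+BK$ is Schur stable (all eigenvalues have magnitude strictly less than one) and $P$ solves the discrete-time Lyapunov equation $$(A+BK)'P(A+BK)-P=-(Q+K'RK),$$ then on $\mathcal X_F$ the control law is defined (minimizers exist) and the undisturbed closed loop is a single-valued map: there is a map $f$ such that $f(x)=Ax+B(Kx+c_0^*)$ for every $x\in\mathcal X_F$ and every minimizer $(c^*,\theta^*)$ at $x$. Moreover, there exists a continuous Lyapunov function $W:\mathcal X_F\to\mathbb R$ for the equilibrium point $\overline x_s$ of $x_{n+1}=f(x_n)$. That is, $\overline x_s\in\mathcal X_F$, $f(\overline x_s)=\overline x_s$, $f(\mathcal X_F)\subseteq\mathcal X_F$, $W$ is continuous on $\mathcal X_F$, and there are functions $\alpha_1,\alpha_2,\alpha_3$ of class $\mathcal K_\infty$ such that for all $x\in\mathcal X_F$ $$\alpha_1(\|x-\overline x_s\|)\le W(x)\le\alpha_2(\|x-\overline x_s\|),\qquad W(f(x))\le W(x)-\alpha_3(\|x-\overline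 x_s\|).$$ -/

import Mathlib

open Matrix Filter Topology
open scoped Pointwise

/-- A polytope: the convex hull of finitely many points. -/
def IsPolytope {E : Type*} [AddCommGroup E] [Module ℝ E] (S : Set E) : Prop :=
  ∃ s : Set E, s.Finite ∧ S = convexHull ℝ s

/-- The Pontryagin difference `S ⊖ T`. -/
def pontryaginDiff {E : Type*} [Add E] (S T : Set E) : Set E :=
  {x | ∀ t ∈ T, x + t ∈ S}

/-- Schur stability: all (complex) eigenvalues have magnitude strictly less than one. -/
def IsSchurStable {p : ℕ} (M : Matrix (Fin p) (Fin p) ℝ) : Prop :=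
  ∀ z ∈ spectrum ℂ (M.map (algebraMap ℝ ℂ)), ‖z‖ < 1

/-- The quadratic form `‖v‖_M ^ 2 = v' M v`. -/
def quadForm {k : ℕ} (M : Matrix (Fin k) (Fin k) ℝ) (v : Fin k → ℝ) : ℝ :=
  v ⬝ᵥ (M *ᵥ v)

/-- The Euclidean norm of a vector. -/
noncomputable def euclNorm {k : ℕ} (v : Fin k → ℝ) : ℝ :=
  ‖WithLp.toLp 2 v‖

/-- Functions of class `K_∞` (only the values on `[0, ∞)` matter). -/
structure IsClassKInfty (α : ℝ → ℝ) : Prop where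
  continuousOn : ContinuousOn α (Set.Ici 0)
  strictMonoOn : StrictMonoOn α (Set.Ici 0)
  map_zero : α 0 = 0
  tendsto_atTop : Tendsto α atTop atTop

/-- `W` is a continuous Lyapunov function, on the forward invariant set `D`, for the equilibrium
point `xs` of the discrete-time system `x⁺ = f x`. -/
structure IsContinuousLyapunov {p : ℕ} (f : (Fin p → ℝ) → (Fin p → ℝ)) (D : Set (Fin p → ℝ))
    (xs : Fin p → ℝ) (W : (Fin p → ℝ) → ℝ) : Prop where
  mem : xs ∈ D
  equilibrium : f xs = xs
  mapsTo : Set.MapsTo f D D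
  continuousOn : ContinuousOn W D
  bounds : ∃ α₁ α₂ : ℝ → ℝ, IsClassKInfty α₁ ∧ IsClassKInfty α₂ ∧
    ∀ x ∈ D, α₁ (euclNorm (x - xs)) ≤ W x ∧ W x ≤ α₂ (euclNorm (x - xs))
  decrease : ∃ α₃ : ℝ → ℝ, IsClassKInfty α₃ ∧
    ∀ x ∈ D, W (f x) ≤ W x - α₃ (euclNorm (x - xs))

/-- The data of linear MPC for tracking with horizon `N`, `p` states and `m` inputs. These are
bare data; all requirements on them are stated separately. -/
structure LinearMPC (p m N : ℕ) where
  /-- the nominal model `x⁺ = A x + B u + d`, `d ∈ 𝒲` -/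
  A : Matrix (Fin p) (Fin p) ℝ
  B : Matrix (Fin p) (Fin m) ℝ
  /-- the feedback gain -/
  K : Matrix (Fin m) (Fin p) ℝ
  /-- the parametrization `x = Λ θ`, `u = Ψ θ` of the steady states -/
  Λ : Matrix (Fin p) (Fin m) ℝ
  Ψ : Matrix (Fin m) (Fin m) ℝ
  /-- state constraints, input constraints, disturbance set -/
  𝒳 : Set (Fin p → ℝ)
  𝒰 : Set (Fin m → ℝ)
  𝒲 : Set (Fin p → ℝ)
  /-- the terminal set -/
  Ω : Set ((Fin p → ℝ) × (Fin m → ℝ))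
  /-- the weights of the cost -/
  P : Matrix (Fin p) (Fin p) ℝ
  Q : Matrix (Fin p) (Fin p) ℝ
  R : Matrix (Fin m) (Fin m) ℝ
  T : Matrix (Fin p) (Fin p) ℝ
  /-- the target -/
  xs : Fin p → ℝ

namespace LinearMPC

variable {p m N : ℕ} (S : LinearMPC p m N)

/-- `range [Λ; Ψ] = null [I - A, -B]`: the pairs `(Λ θ, Ψ θ)` are exactly the steady states. -/
def ParametrizesSteadyStates : Prop :=
  LinearMap.range (Matrix.fromRows S.Λ S.Ψ).mulVecLin =
    LinearMap.ker (Matrix.fromCols (1 - S.A) (-S.B)).mulVecLin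

/-- Constraint satisfaction of the terminal set. -/
def ConstraintSatisfaction : Prop :=
  S.Ω ⊆ {z | z.1 ∈ S.𝒳 ∧ S.Λ *ᵥ z.2 ∈ S.𝒳 ∧
    S.K *ᵥ z.1 + (S.Ψ - S.K * S.Λ) *ᵥ z.2 ∈ S.𝒰 ∧ S.Ψ *ᵥ z.2 ∈ S.𝒰}

/-- Disturbance invariance of the terminal set. -/
def DisturbanceInvariant : Prop :=
  (fun z : (Fin p → ℝ) × (Fin m → ℝ) =>
      ((S.A + S.B * S.K) *ᵥ z.1 + (S.B * (S.Ψ - S.K * S.Λ)) *ᵥ z.2, z.2)) '' S.Ω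
    + S.𝒲 ×ˢ {0} ⊆ S.Ω

/-- The tube cross-section `ℛ_i = ⨁_{j < i} (A + B K)^j 𝒲`, with `ℛ_0 = {0}`. -/
def tube (i : ℕ) : Set (Fin p → ℝ) :=
  ∑ j ∈ Finset.range i, (fun w => ((S.A + S.B * S.K) ^ j) *ᵥ w) '' S.𝒲

/-- The nominal state predicted `i` steps ahead of `x`, under the inputs `K x̄_i + c_i`
(`c` is continued by `0` beyond the horizon, where it is never used). -/
def predState (x : Fin p → ℝ) (c : Fin N → Fin m → ℝ) : ℕ → (Fin p → ℝ)
  | 0 => x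
  | i + 1 => S.A *ᵥ predState x c i +
      S.B *ᵥ (S.K *ᵥ predState x c i + if h : i < N then c ⟨i, h⟩ else 0)

/-- The predicted input `ǔ_i = K x̄_i + c_i`, for `i < N`. -/
def predInput (x : Fin p → ℝ) (c : Fin N → Fin m → ℝ) (i : Fin N) : Fin m → ℝ :=
  S.K *ᵥ S.predState x c i + c i

/-- Feasibility of the decision variables `(c, θ)` at the initial state `x`. -/
def IsFeasible (x : Fin p → ℝ) (c : Fin N → Fin m → ℝ) (θ : Fin m → ℝ) : Prop :=
  (∀ i : Fin N,
    S.predState x c (i + 1) ∈ pontryaginDiff S.𝒳 (S.tube i) ∧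
    S.predInput x c i ∈ pontryaginDiff S.𝒰 ((fun r => S.K *ᵥ r) '' S.tube i)) ∧
  (S.predState x c N, θ) ∈ pontryaginDiff S.Ω (S.tube N ×ˢ {0})

/-- The feasible region `𝒳_F`. -/
def feasibleRegion : Set (Fin p → ℝ) :=
  {x | ∃ c θ, S.IsFeasible x c θ}

/-- The quadratic tracking cost. -/
def cost (x : Fin p → ℝ) (c : Fin N → Fin m → ℝ) (θ : Fin m → ℝ) : ℝ :=
  quadForm S.P (S.predState x c N - S.Λ *ᵥ θ) + quadForm S.T (S.xs - S.Λ *ᵥ θ) +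
    ∑ i : Fin N, (quadForm S.Q (S.predState x c i - S.Λ *ᵥ θ) +
      quadForm S.R (S.predInput x c i - S.Ψ *ᵥ θ))

/-- `(c, θ)` solves the linear MPC optimization problem at the state `x`. -/
def IsMinimizer (x : Fin p → ℝ) (c : Fin N → Fin m → ℝ) (θ : Fin m → ℝ) : Prop :=
  S.IsFeasible x c θ ∧ ∀ c' θ', S.IsFeasible x c' θ' → S.cost x c θ ≤ S.cost x c' θ'

/-- The possible successors of `x` in closed loop with the linear MPC control law: the states
`A x + B (K x + c_0)` for the minimizers `(c, θ)` at `x`. -/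
def successors [NeZero N] (x : Fin p → ℝ) : Set (Fin p → ℝ) :=
  {x' | ∃ c θ, S.IsMinimizer x c θ ∧ x' = S.A *ᵥ x + S.B *ᵥ (S.K *ᵥ x + c 0)}

end LinearMPC

/-! The optimal cost `value` is the natural Lyapunov function, and one defect has to be repaired. It
is convex, because the cost and the constraints are jointly convex in state and decision variables.
Convexity gives continuity only in the interior of the feasible region, so the boundary needs
another argument.

Decrease: shift the optimal inputs by one step and append the terminal controller. By the Lyapunov
equation the cost drops by at least `quadForm Q (x - Λ θ)` (`cost_shift`). This controls the
distance to the target, not only to the artificial steady state `Λ θ`: if `x` were near `Λ θ` but `Λ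
θ` far from the target, moving `θ` towards the target would lower the cost
(`exists_le_quadForm_of_isMinimizer`).

Continuity: the tightened constraints leave room for a disturbance, so the shifted inputs stay
feasible after any small perturbation of the successor (`feasible_shift`). Hence a uniform
neighbourhood of the image of `f` lies in the feasible region, and `value` is continuous there. Away
from the image, `value` is blended into a continuous function `M + κ ‖x - xs‖ ^ 2`, with `M` a bound
for `value` on the image. Since the blend equals `value` on the image, the decrease survives
(`exists_isContinuousLyapunov_of_convexOn`). -/

section QuadForm

/-! ### Quadratic forms and norm comparison. -/

variable {k : ℕ}

theorem quadForm_nonneg {M : Matrix (Fin k) (Fin k) ℝ} (hM : M.PosDef) (v : Fin k → ℝ) :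
    0 ≤ quadForm M v := by
  simpa [quadForm] using hM.posSemidef.dotProduct_mulVec_nonneg v

theorem quadForm_pos {M : Matrix (Fin k) (Fin k) ℝ} (hM : M.PosDef) {v : Fin k → ℝ}
    (hv : v ≠ 0) : 0 < quadForm M v := by
  simpa [quadForm] using hM.dotProduct_mulVec_pos hv

theorem quadForm_smul (M : Matrix (Fin k) (Fin k) ℝ) (a : ℝ) (v : Fin k → ℝ) :
    quadForm M (a • v) = a ^ 2 * quadForm M v := by
  simp only [quadForm, mulVec_smul, dotProduct_smul, smul_dotProduct, smul_eq_mul]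
  ring

/-- The exact convexity defect is kept because it is what later forces two minimizers to share a
successor. -/
theorem quadForm_combo (M : Matrix (Fin k) (Fin k) ℝ) {a b : ℝ} (hab : a + b = 1)
    (u v : Fin k → ℝ) :
    quadForm M (a • u + b • v)
      = a * quadForm M u + b * quadForm M v - a * b * quadForm M (u - v) := by
  obtain rfl : b = 1 - a := by linarith
  simp only [quadForm, mulVec_add, mulVec_sub, mulVec_smul, dotProduct_add, add_dotProduct,
    dotProduct_sub, sub_dotProduct, dotProduct_smul, smul_dotProduct, smul_eq_mul]
  ring

theorem continuous_quadForm (M : Matrix (Fin k) (Fin k) ℝ) : Continuous (quadForm M) := by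
  unfold quadForm
  fun_prop

theorem quadForm_norm_smul (M : Matrix (Fin k) (Fin k) ℝ) {v : Fin k → ℝ} (hv : v ≠ 0) :
    quadForm M v = quadForm M (‖v‖⁻¹ • v) * ‖v‖ ^ 2 := by
  have : ‖v‖ ≠ 0 := norm_ne_zero_iff.2 hv
  rw [quadForm_smul]
  field_simp

theorem exists_quadForm_le (M : Matrix (Fin k) (Fin k) ℝ) :
    ∃ C > 0, ∀ v, quadForm M v ≤ C * ‖v‖ ^ 2 := by
  obtain ⟨C, hC⟩ := (isCompact_sphere (0 : Fin k → ℝ) 1).exists_bound_of_continuousOn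
    (continuous_quadForm M).continuousOn
  refine ⟨max C 1, by positivity, fun v => ?_⟩
  by_cases hv : v = 0
  · simp [hv, quadForm]
  rw [quadForm_norm_smul M hv]
  have h := hC (‖v‖⁻¹ • v) (by simp [norm_smul, hv])
  have h2 := (le_abs_self _).trans h
  gcongr
  exact h2.trans (le_max_left _ _)

theorem exists_le_quadForm {M : Matrix (Fin k) (Fin k) ℝ} (hM : M.PosDef) :
    ∃ c > 0, ∀ v, c * ‖v‖ ^ 2 ≤ quadForm M v := by
  -- The sphere is empty when `k = 0`, and there is then no minimum to take.
  rcases (Metric.sphere (0 : Fin k → ℝ) 1).eq_empty_or_nonempty with h | h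
  · refine ⟨1, one_pos, fun v => ?_⟩
    by_cases hv : v = 0
    · simp [hv, quadForm]
    · have : ‖v‖⁻¹ • v ∈ Metric.sphere (0 : Fin k → ℝ) 1 := by simp [norm_smul, hv]
      simp [h] at this
  · obtain ⟨u, hu, hmin⟩ := (isCompact_sphere (0 : Fin k → ℝ) 1).exists_isMinOn h
      (continuous_quadForm M).continuousOn
    have hu0 : u ≠ 0 := by
      rintro rfl
      simp at hu
    refine ⟨quadForm M u, quadForm_pos hM hu0, fun v => ?_⟩
    by_cases hv : v = 0
    · simp [hv, quadForm]
    rw [quadForm_norm_smul M hv]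
    gcongr
    exact hmin (by simp [norm_smul, hv])

/-- All estimates are made in the sup norm of `Fin k → ℝ`; this and `exists_euclNorm_le` transfer
them to the Euclidean norm at the end. -/
theorem norm_le_euclNorm (v : Fin k → ℝ) : ‖v‖ ≤ euclNorm v :=
  (pi_norm_le_iff_of_nonneg (norm_nonneg (WithLp.toLp 2 v))).2
    fun i => PiLp.norm_apply_le (WithLp.toLp 2 v) i

theorem exists_euclNorm_le : ∃ C > 0, ∀ v : Fin k → ℝ, euclNorm v ≤ C * ‖v‖ := by
  let e : (Fin k → ℝ) →L[ℝ] PiLp 2 (fun _ : Fin k => ℝ) :=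
    (PiLp.continuousLinearEquiv 2 ℝ (fun _ : Fin k => ℝ)).symm.toContinuousLinearMap
  refine ⟨‖e‖ + 1, by positivity, fun v => ?_⟩
  calc euclNorm v = ‖e v‖ := rfl
    _ ≤ ‖e‖ * ‖v‖ := ContinuousLinearMap.le_opNorm _ _
    _ ≤ _ := by gcongr; linarith

end QuadForm

/-! ### Comparison functions, Pontryagin differences, polytopes. -/

theorem isClassKInfty_linear_add_quadratic {a b : ℝ} (ha : 0 ≤ a) (hb : 0 < b) :
    IsClassKInfty fun s => a * s + b * s ^ 2 where
  continuousOn := by fun_prop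
  strictMonoOn := by
    intro x hx y hy hxy
    have hx : 0 ≤ x := hx
    have : x ^ 2 < y ^ 2 := by gcongr
    have h1 : a * x ≤ a * y := by gcongr
    have h2 : b * x ^ 2 < b * y ^ 2 := by gcongr
    exact add_lt_add_of_le_of_lt h1 h2
  map_zero := by simp
  tendsto_atTop := by
    have h : Tendsto (fun s : ℝ => b * s ^ 2) atTop atTop :=
      (tendsto_pow_atTop two_ne_zero).const_mul_atTop hb
    refine tendsto_atTop_mono' _ ?_ h
    filter_upwards [eventually_ge_atTop 0] with s hs
    have := mul_nonneg ha hs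
    linarith

theorem isClosed_pontryaginDiff {E : Type*} [AddCommGroup E] [TopologicalSpace E]
    [ContinuousAdd E] {S : Set E} (hS : IsClosed S) (T : Set E) :
    IsClosed (pontryaginDiff S T) := by
  simp only [pontryaginDiff, Set.ofPred_forall]
  exact isClosed_biInter fun t _ => hS.preimage (continuous_add_const t)

theorem convex_pontryaginDiff {E : Type*} [AddCommGroup E] [Module ℝ E] {S : Set E}
    (hS : Convex ℝ S) (T : Set E) : Convex ℝ (pontryaginDiff S T) := by
  intro x hx y hy a b ha hb hab t ht
  have h := hS (hx t ht) (hy t ht) ha hb hab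
  have : a • x + b • y + t = a • (x + t) + b • (y + t) := by
    obtain rfl : b = 1 - a := by linarith
    module
  rwa [this]

theorem IsPolytope.isCompact {k : ℕ} {S : Set (Fin k → ℝ)} (h : IsPolytope S) :
    IsCompact S := by
  obtain ⟨s, hs, rfl⟩ := h
  exact hs.isCompact_convexHull ℝ

theorem IsPolytope.convex {k : ℕ} {S : Set (Fin k → ℝ)} (h : IsPolytope S) :
    Convex ℝ S := by
  obtain ⟨s, hs, rfl⟩ := h
  exact convex_convexHull ℝ s

/-! ### Predicted trajectories. -/

namespace LinearMPC

variable {p m N : ℕ} (S : LinearMPC p m N)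

/-- The closed-loop matrix `A + B K`. -/
def closedLoop : Matrix (Fin p) (Fin p) ℝ := S.A + S.B * S.K

/-- The feedforward term `(Ψ - K Λ) θ` that keeps the steady state `Λ θ` fixed. -/
def feedforward (θ : Fin m → ℝ) : Fin m → ℝ := (S.Ψ - S.K * S.Λ) *ᵥ θ

/-- The state after `i` steps from `x` under the inputs `K x_i + v_i`. -/
def traj (x : Fin p → ℝ) (v : ℕ → Fin m → ℝ) : ℕ → (Fin p → ℝ)
  | 0 => x
  | i + 1 => S.closedLoop *ᵥ traj x v i + S.B *ᵥ v i

/-- The input `K x_i + v_i` at time `i`. -/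
def trajInput (x : Fin p → ℝ) (v : ℕ → Fin m → ℝ) (i : ℕ) : Fin m → ℝ :=
  S.K *ᵥ S.traj x v i + v i

/-- Continuation of a finite sequence of input corrections by a constant. -/
def extend (c : Fin N → Fin m → ℝ) (d : Fin m → ℝ) (i : ℕ) : Fin m → ℝ :=
  if h : i < N then c ⟨i, h⟩ else d

omit S in
theorem extend_restrict (c : Fin N → Fin m → ℝ) (d : Fin m → ℝ) :
    (fun i : Fin N => extend c d i) = c := by
  funext i
  simp [extend]

@[simp]
theorem traj_zero (x : Fin p → ℝ) (v : ℕ → Fin m → ℝ) : S.traj x v 0 = x := rfl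

theorem traj_succ (x : Fin p → ℝ) (v : ℕ → Fin m → ℝ) (i : ℕ) :
    S.traj x v (i + 1) = S.closedLoop *ᵥ S.traj x v i + S.B *ᵥ v i := rfl

theorem traj_succ_eq (x : Fin p → ℝ) (v : ℕ → Fin m → ℝ) (i : ℕ) :
    S.traj x v (i + 1) = S.A *ᵥ S.traj x v i + S.B *ᵥ S.trajInput x v i := by
  simp only [traj_succ, closedLoop, trajInput, add_mulVec, mulVec_add, mulVec_mulVec]
  abel

theorem traj_shift (x : Fin p → ℝ) (v : ℕ → Fin m → ℝ) (i : ℕ) :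
    S.traj (S.traj x v 1) (fun j => v (j + 1)) i = S.traj x v (i + 1) := by
  induction i with
  | zero => rfl
  | succ i ih => rw [traj_succ, ih, ← traj_succ]

theorem traj_add (x w : Fin p → ℝ) (v : ℕ → Fin m → ℝ) (i : ℕ) :
    S.traj (x + w) v i = S.traj x v i + S.closedLoop ^ i *ᵥ w := by
  induction i with
  | zero => simp
  | succ i ih =>
    rw [traj_succ, ih, traj_succ, mulVec_add, mulVec_mulVec, pow_succ']
    abel

theorem traj_combo {a b : ℝ} (x y : Fin p → ℝ) (v w : ℕ → Fin m → ℝ) (i : ℕ) :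
    S.traj (a • x + b • y) (a • v + b • w) i = a • S.traj x v i + b • S.traj y w i := by
  induction i with
  | zero => rfl
  | succ i ih =>
    simp only [traj_succ, ih, Pi.add_apply, Pi.smul_apply, mulVec_add, mulVec_smul, smul_add]
    abel

theorem continuous_predState (x : Fin p → ℝ) (i : ℕ) :
    Continuous fun c : Fin N → Fin m → ℝ => S.predState x c i := by
  induction i with
  | zero => exact continuous_const
  | succ i ih =>
    simp only [predState]
    split_ifs <;> fun_prop

theorem continuous_predInput (x : Fin p → ℝ) (i : Fin N) :
    Continuous fun c : Fin N → Fin m → ℝ => S.predInput x c i := by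
  have := S.continuous_predState x i
  unfold predInput
  fun_prop

/-- With infinite correction sequences, the shifted candidate is just `fun i => v (i + 1)`, with no
case split at the end of the horizon. The predictions agree through time `N` because reaching it
uses only corrections with index below `N`. -/
theorem predState_eq (x : Fin p → ℝ) (v : ℕ → Fin m → ℝ) {i : ℕ} (hi : i ≤ N) :
    S.predState x (fun j => v j) i = S.traj x v i := by
  induction i with
  | zero => rfl
  | succ i ih =>
    have h : i < N := hi
    simp only [predState, ih h.le, h, dite_true, traj_succ_eq, trajInput]

theorem predInput_eq (x : Fin p → ℝ) (v : ℕ → Fin m → ℝ) (i : Fin N) :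
    S.predInput x (fun j => v j) i = S.trajInput x v i := by
  rw [predInput, predState_eq _ _ _ i.2.le, trajInput]

theorem isFeasible_restrict_iff (x : Fin p → ℝ) (v : ℕ → Fin m → ℝ) (θ : Fin m → ℝ) :
    S.IsFeasible x (fun j => v j) θ ↔
      (∀ i < N, (∀ r ∈ S.tube i, S.traj x v (i + 1) + r ∈ S.𝒳) ∧
        ∀ r ∈ S.tube i, S.trajInput x v i + S.K *ᵥ r ∈ S.𝒰) ∧
      ∀ r ∈ S.tube N, (S.traj x v N + r, θ) ∈ S.Ω := by
  simp only [IsFeasible, pontryaginDiff, Set.mem_ofPred_eq, predInput_eq, predState_eq _ _ _ le_rfl,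
    Set.forall_mem_image, Fin.forall_iff]
  refine and_congr (forall₂_congr fun i hi => ?_) ?_
  · rw [predState_eq _ _ _ (Nat.succ_le_of_lt hi)]
  · simp [Set.mem_prod]

theorem cost_restrict (x : Fin p → ℝ) (v : ℕ → Fin m → ℝ) (θ : Fin m → ℝ) :
    S.cost x (fun j => v j) θ =
      quadForm S.P (S.traj x v N - S.Λ *ᵥ θ) + quadForm S.T (S.xs - S.Λ *ᵥ θ) +
      ∑ i ∈ Finset.range N, (quadForm S.Q (S.traj x v i - S.Λ *ᵥ θ) +
        quadForm S.R (S.trajInput x v i - S.Ψ *ᵥ θ)) := by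
  rw [cost, predState_eq _ _ _ le_rfl, Finset.sum_range]
  congr 1
  refine Finset.sum_congr rfl fun i _ => ?_
  rw [predState_eq _ _ _ i.2.le, predInput_eq]

/-- Every pair `(c, θ)` is the restriction of an infinite sequence of corrections that continues
with the feedforward term. -/
theorem exists_restrict_eq (c : Fin N → Fin m → ℝ) (θ : Fin m → ℝ) :
    ∃ v : ℕ → Fin m → ℝ, (fun j : Fin N => v j) = c ∧ ∀ i, N ≤ i → v i = S.feedforward θ :=
  ⟨extend c (S.feedforward θ), extend_restrict _ _, fun i hi => by simp [extend, hi]⟩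

/-! ### The disturbance tube -/

theorem mem_tube_zero {r : Fin p → ℝ} : r ∈ S.tube 0 ↔ r = 0 := by
  simp [tube]

theorem mem_tube_succ {n : ℕ} {r : Fin p → ℝ} :
    r ∈ S.tube (n + 1) ↔ ∃ r' ∈ S.tube n, ∃ w ∈ S.𝒲, r' + S.closedLoop ^ n *ᵥ w = r := by
  simp only [tube, Finset.sum_range_succ, Set.mem_add, Set.exists_mem_image, closedLoop]

theorem add_mem_tube_succ {n : ℕ} {r w : Fin p → ℝ} (hr : r ∈ S.tube n) (hw : w ∈ S.𝒲) :
    S.closedLoop ^ n *ᵥ w + r ∈ S.tube (n + 1) :=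
  S.mem_tube_succ.2 ⟨r, hr, w, hw, add_comm _ _⟩

theorem mem_tube_succ_of_mem (h0 : 0 ∈ S.𝒲) {n : ℕ} {r : Fin p → ℝ} (hr : r ∈ S.tube n) :
    r ∈ S.tube (n + 1) := by
  simpa using S.add_mem_tube_succ hr h0

theorem tube_mono (h0 : 0 ∈ S.𝒲) : Monotone S.tube :=
  monotone_nat_of_le_succ fun _ _ hr => S.mem_tube_succ_of_mem h0 hr

theorem zero_mem_tube (h0 : 0 ∈ S.𝒲) (n : ℕ) : 0 ∈ S.tube n :=
  S.tube_mono h0 n.zero_le (S.mem_tube_zero.2 rfl)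

/-- `mem_tube_succ` splits off the oldest disturbance, already propagated `n` times; here the newest
one is split off, the form needed to apply one-step invariance of the terminal set. -/
theorem exists_of_mem_tube_succ {n : ℕ} {r : Fin p → ℝ} (hr : r ∈ S.tube (n + 1)) :
    ∃ r' ∈ S.tube n, ∃ w ∈ S.𝒲, S.closedLoop *ᵥ r' + w = r := by
  induction n generalizing r with
  | zero =>
    obtain ⟨r', hr', w, hw, rfl⟩ := S.mem_tube_succ.1 hr
    rw [mem_tube_zero] at hr'
    exact ⟨0, S.mem_tube_zero.2 rfl, w, hw, by simp [hr']⟩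
  | succ n ih =>
    obtain ⟨r₁, hr₁, w, hw, rfl⟩ := S.mem_tube_succ.1 hr
    obtain ⟨r₂, hr₂, w', hw', rfl⟩ := ih hr₁
    refine ⟨r₂ + S.closedLoop ^ n *ᵥ w, S.mem_tube_succ.2 ⟨r₂, hr₂, w, hw, rfl⟩, w', hw', ?_⟩
    rw [mulVec_add, mulVec_mulVec, pow_succ']
    abel

/-! ### Steady states -/

section Steady

variable {S}

theorem ParametrizesSteadyStates.steady (h : S.ParametrizesSteadyStates) (θ : Fin m → ℝ) :
    S.A *ᵥ (S.Λ *ᵥ θ) + S.B *ᵥ (S.Ψ *ᵥ θ) = S.Λ *ᵥ θ := by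
  have h1 : (Matrix.fromRows S.Λ S.Ψ).mulVecLin θ ∈
      LinearMap.ker (Matrix.fromCols (1 - S.A) (-S.B)).mulVecLin := by
    rw [← h]
    exact ⟨θ, rfl⟩
  rw [LinearMap.mem_ker, mulVecLin_apply, mulVecLin_apply, fromRows_mulVec,
    fromCols_mulVec_sumElim, sub_mulVec, one_mulVec, neg_mulVec] at h1
  rw [eq_comm, ← sub_eq_zero, ← h1]
  abel

theorem ParametrizesSteadyStates.closedLoop_steady (h : S.ParametrizesSteadyStates)
    (θ : Fin m → ℝ) :
    S.closedLoop *ᵥ (S.Λ *ᵥ θ) + S.B *ᵥ S.feedforward θ = S.Λ *ᵥ θ := by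
  conv_rhs => rw [← h.steady θ]
  simp only [closedLoop, feedforward, add_mulVec, sub_mulVec, mulVec_sub, mulVec_mulVec,
    Matrix.add_mul, Matrix.mul_assoc]
  abel

/-- Under the feedforward term, deviations from `Λ θ` evolve linearly by `closedLoop`. -/
theorem ParametrizesSteadyStates.step (h : S.ParametrizesSteadyStates)
    (x : Fin p → ℝ) (θ : Fin m → ℝ) :
    S.closedLoop *ᵥ x + S.B *ᵥ S.feedforward θ
      = S.Λ *ᵥ θ + S.closedLoop *ᵥ (x - S.Λ *ᵥ θ) := by
  rw [mulVec_sub, eq_sub_of_add_eq' (h.closedLoop_steady θ)]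
  abel

/-- The parametrization of the steady states is injective, by a dimension count. -/
theorem ParametrizesSteadyStates.injective (h : S.ParametrizesSteadyStates) :
    Function.Injective (Matrix.fromRows S.Λ S.Ψ).mulVecLin := by
  rw [← LinearMap.ker_eq_bot, ← Submodule.finrank_eq_zero (R := ℝ)]
  -- The null space of a map from dimension `p + m` to dimension `p` has dimension at least `m`;
  -- being the range of a map from dimension `m`, it leaves no room for a kernel.
  have h1 := LinearMap.finrank_range_add_finrank_ker (Matrix.fromRows S.Λ S.Ψ).mulVecLin
  have h2 := LinearMap.finrank_range_add_finrank_ker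
    (Matrix.fromCols (1 - S.A) (-S.B)).mulVecLin
  have h3 := Submodule.finrank_le (LinearMap.range (Matrix.fromCols (1 - S.A) (-S.B)).mulVecLin)
  rw [h] at h1
  simp only [Module.finrank_fintype_fun_eq_card, Fintype.card_sum, Fintype.card_fin] at h1 h2 h3
  omega

theorem trajInput_sub_feedforward {x : Fin p → ℝ} {v : ℕ → Fin m → ℝ} {θ : Fin m → ℝ} {i : ℕ}
    (hv : v i = S.feedforward θ) :
    S.trajInput x v i - S.Ψ *ᵥ θ = S.K *ᵥ (S.traj x v i - S.Λ *ᵥ θ) := by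
  simp only [trajInput, hv, feedforward, sub_mulVec, mulVec_sub, mulVec_mulVec]
  abel

theorem ParametrizesSteadyStates.traj_succ_of_eq (h : S.ParametrizesSteadyStates)
    {x : Fin p → ℝ} {v : ℕ → Fin m → ℝ} {θ : Fin m → ℝ} {i : ℕ}
    (hv : v i = S.feedforward θ) :
    S.traj x v (i + 1) = S.Λ *ᵥ θ + S.closedLoop *ᵥ (S.traj x v i - S.Λ *ᵥ θ) := by
  rw [traj_succ, hv, h.step]

theorem ParametrizesSteadyStates.traj_feedforward (h : S.ParametrizesSteadyStates)
    (x : Fin p → ℝ) (θ : Fin m → ℝ) (i : ℕ) :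
    S.traj x (fun _ => S.feedforward θ) i
      = S.Λ *ᵥ θ + S.closedLoop ^ i *ᵥ (x - S.Λ *ᵥ θ) := by
  induction i with
  | zero => simp
  | succ i ih =>
    rw [h.traj_succ_of_eq rfl, ih, add_sub_cancel_left, mulVec_mulVec, pow_succ']

end Steady

/-! ### The Lyapunov equation -/

section Lyapunov

variable {S}

/-- The Lyapunov equation evaluated at `e`: the stage cost of the terminal controller is exactly the
drop of the terminal cost, so sums telescope. -/
theorem quadForm_closedLoop
    (hLyap : (S.A + S.B * S.K)ᵀ * S.P * (S.A + S.B * S.K) - S.P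
      = -(S.Q + S.Kᵀ * S.R * S.K)) (e : Fin p → ℝ) :
    quadForm S.Q e + quadForm S.R (S.K *ᵥ e)
      = quadForm S.P e - quadForm S.P (S.closedLoop *ᵥ e) := by
  have h := congrArg (fun M => e ⬝ᵥ (M *ᵥ e)) hLyap
  have key : ∀ {k l : ℕ} (F : Matrix (Fin k) (Fin l) ℝ) (M : Matrix (Fin k) (Fin k) ℝ)
      (e : Fin l → ℝ), e ⬝ᵥ ((Fᵀ * M * F) *ᵥ e) = quadForm M (F *ᵥ e) := by
    intro k l F M e
    rw [quadForm, ← mulVec_mulVec, ← mulVec_mulVec, dotProduct_mulVec, vecMul_transpose]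
  simp only [sub_mulVec, neg_mulVec, add_mulVec S.Q, dotProduct_sub, dotProduct_neg,
    dotProduct_add, key] at h
  simp only [quadForm, closedLoop] at h ⊢
  linarith

theorem sum_quadForm_closedLoop
    (hLyap : (S.A + S.B * S.K)ᵀ * S.P * (S.A + S.B * S.K) - S.P
      = -(S.Q + S.Kᵀ * S.R * S.K)) (e : Fin p → ℝ) (n : ℕ) :
    ∑ i ∈ Finset.range n, (quadForm S.Q (S.closedLoop ^ i *ᵥ e) +
        quadForm S.R (S.K *ᵥ (S.closedLoop ^ i *ᵥ e)))
      = quadForm S.P e - quadForm S.P (S.closedLoop ^ n *ᵥ e) := by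
  induction n with
  | zero => simp
  | succ n ih =>
    rw [Finset.sum_range_succ, ih, quadForm_closedLoop hLyap, mulVec_mulVec, pow_succ']
    ring

/-- A positive definite solution of the Lyapunov equation forces the powers of the closed-loop
matrix to vanish asymptotically. -/
theorem tendsto_closedLoop_pow (hP : S.P.PosDef) (hQ : S.Q.PosDef) (hR : S.R.PosDef)
    (hLyap : (S.A + S.B * S.K)ᵀ * S.P * (S.A + S.B * S.K) - S.P
      = -(S.Q + S.Kᵀ * S.R * S.K)) (e : Fin p → ℝ) :
    Tendsto (fun n => S.closedLoop ^ n *ᵥ e) atTop (𝓝 0) := by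
  obtain ⟨c, hc, hle⟩ := exists_le_quadForm hQ
  -- Telescoping bounds the total stage cost by `quadForm P e`, so its terms tend to zero.
  have hs : Summable fun n => quadForm S.Q (S.closedLoop ^ n *ᵥ e) := by
    refine summable_of_sum_range_le (c := quadForm S.P e) (fun n => quadForm_nonneg hQ _)
      fun n => ?_
    calc ∑ i ∈ Finset.range n, quadForm S.Q (S.closedLoop ^ i *ᵥ e)
        ≤ ∑ i ∈ Finset.range n, (quadForm S.Q (S.closedLoop ^ i *ᵥ e) +
          quadForm S.R (S.K *ᵥ (S.closedLoop ^ i *ᵥ e))) :=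
          Finset.sum_le_sum fun i _ => le_add_of_nonneg_right (quadForm_nonneg hR _)
      _ ≤ quadForm S.P e := by
          rw [sum_quadForm_closedLoop hLyap]
          exact sub_le_self _ (quadForm_nonneg hP _)
  have h1 : Tendsto (fun n => ‖S.closedLoop ^ n *ᵥ e‖ ^ 2) atTop (𝓝 0) := by
    have h2 := hs.tendsto_atTop_zero.const_mul c⁻¹
    rw [mul_zero] at h2
    refine squeeze_zero (fun n => by positivity) (fun n => ?_) h2
    rw [le_inv_mul_iff₀ hc]
    exact hle _
  rw [tendsto_zero_iff_norm_tendsto_zero]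
  have h3 := h1.sqrt
  simpa using h3

end Lyapunov

end LinearMPC

namespace LinearMPC

variable {p m N : ℕ} {S : LinearMPC p m N}

/-! ### Admissible steady states -/

/-- The tube around the steady state `Λ θ` stays in the terminal set. -/
def IsAdmissible (S : LinearMPC p m N) (θ : Fin m → ℝ) : Prop :=
  ∀ n, ∀ r ∈ S.tube n, (S.Λ *ᵥ θ + r, θ) ∈ S.Ω

theorem DisturbanceInvariant.step_mem (hinv : S.DisturbanceInvariant)
    (hss : S.ParametrizesSteadyStates) {x w : Fin p → ℝ} {θ : Fin m → ℝ}
    (hx : (x, θ) ∈ S.Ω) (hw : w ∈ S.𝒲) :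
    (S.Λ *ᵥ θ + S.closedLoop *ᵥ (x - S.Λ *ᵥ θ) + w, θ) ∈ S.Ω := by
  have h := hinv (Set.add_mem_add (Set.mem_image_of_mem _ hx)
    (Set.mk_mem_prod hw (Set.mem_singleton (0 : Fin m → ℝ))))
  rw [← hss.step]
  simpa [closedLoop, feedforward, mulVec_mulVec] using h

/-- Iterated invariance: the oldest disturbance acts in the first step, and the induction hypothesis
runs from the resulting point. -/
theorem DisturbanceInvariant.pow_add_tube_mem (hinv : S.DisturbanceInvariant)
    (hss : S.ParametrizesSteadyStates) {θ : Fin m → ℝ} (n : ℕ) {x r : Fin p → ℝ}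
    (hx : (x, θ) ∈ S.Ω) (hr : r ∈ S.tube n) :
    (S.Λ *ᵥ θ + S.closedLoop ^ n *ᵥ (x - S.Λ *ᵥ θ) + r, θ) ∈ S.Ω := by
  induction n generalizing x r with
  | zero =>
    rw [mem_tube_zero] at hr
    simpa [hr] using hx
  | succ n ih =>
    obtain ⟨r', hr', w, hw, rfl⟩ := S.mem_tube_succ.1 hr
    convert ih (hinv.step_mem hss hx hw) hr' using 2
    rw [add_assoc (S.Λ *ᵥ θ) (S.closedLoop *ᵥ _) w, add_sub_cancel_left, mulVec_add,
      mulVec_mulVec, pow_succ]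
    abel

/-- Run `k` undisturbed steps from `x`, then `n` disturbed ones, all inside `Ω`. As `k → ∞` the
initial deviation from `Λ θ` dies out, and `Ω` is closed. -/
theorem isAdmissible_of_mem (hinv : S.DisturbanceInvariant) (hss : S.ParametrizesSteadyStates)
    (hΩ : IsClosed S.Ω) (h0 : 0 ∈ S.𝒲)
    (hpow : ∀ e, Tendsto (fun n => S.closedLoop ^ n *ᵥ e) atTop (𝓝 0))
    {x : Fin p → ℝ} {θ : Fin m → ℝ} (hx : (x, θ) ∈ S.Ω) : S.IsAdmissible θ := by
  intro n r hr
  have hmem : ∀ k, (S.Λ *ᵥ θ + S.closedLoop ^ n *ᵥ (S.closedLoop ^ k *ᵥ (x - S.Λ *ᵥ θ)) + r, θ)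
      ∈ S.Ω := fun k => by
    have h := hinv.pow_add_tube_mem hss n (hinv.pow_add_tube_mem hss k hx (S.zero_mem_tube h0 k)) hr
    rwa [add_zero, add_sub_cancel_left] at h
  refine hΩ.mem_of_tendsto (b := atTop) ?_ (Eventually.of_forall hmem)
  have hc : Continuous fun e : Fin p → ℝ => (S.Λ *ᵥ θ + S.closedLoop ^ n *ᵥ e + r, θ) := by
    fun_prop
  have h := (hc.tendsto 0).comp (hpow (x - S.Λ *ᵥ θ))
  rw [mulVec_zero, add_zero] at h
  exact h

theorem IsAdmissible.combo (hΩ : Convex ℝ S.Ω) {θ θ' : Fin m → ℝ} (h : S.IsAdmissible θ)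
    (h' : S.IsAdmissible θ') {a b : ℝ} (ha : 0 ≤ a) (hb : 0 ≤ b) (hab : a + b = 1) :
    S.IsAdmissible (a • θ + b • θ') := by
  intro n r hr
  convert hΩ (h n r hr) (h' n r hr) ha hb hab using 1
  obtain rfl : b = 1 - a := by linarith
  refine Prod.ext ?_ rfl
  simp only [mulVec_add, mulVec_smul, Prod.fst_add, Prod.smul_fst]
  module

/-! ### Feasible candidates -/

theorem terminal_mem (h0 : 0 ∈ S.𝒲) {x : Fin p → ℝ} {c : Fin N → Fin m → ℝ} {θ : Fin m → ℝ}
    (h : S.IsFeasible x c θ) : (S.predState x c N, θ) ∈ S.Ω := by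
  have h1 := h.2 (0, 0) ⟨S.zero_mem_tube h0 N, rfl⟩
  simpa using h1

/-- The initial deviation plays the part of a disturbance: after `i` steps it adds `closedLoop ^ i`
of itself, which the next tube absorbs. The state at time `i + 1` is tightened only by `tube i`, so
the propagated deviation must also lie in `𝒲`. -/
theorem feasible_feedforward (hss : S.ParametrizesSteadyStates)
    (hcs : S.ConstraintSatisfaction) {x : Fin p → ℝ} {θ : Fin m → ℝ} (hθ : S.IsAdmissible θ)
    (hw : x - S.Λ *ᵥ θ ∈ S.𝒲) (hw' : S.closedLoop *ᵥ (x - S.Λ *ᵥ θ) ∈ S.𝒲) :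
    S.IsFeasible x (fun _ => S.feedforward θ) θ := by
  refine (S.isFeasible_restrict_iff x (fun _ => S.feedforward θ) θ).2
    ⟨fun i _ => ⟨fun r hr => ?_, fun r hr => ?_⟩, fun r hr => ?_⟩
  · have h := hθ _ _ (S.add_mem_tube_succ hr hw')
    convert (hcs h).1 using 1
    rw [hss.traj_feedforward, mulVec_mulVec, pow_succ, add_assoc]
  · have h := hθ _ _ (S.add_mem_tube_succ hr hw)
    convert (hcs h).2.2.1 using 1
    simp only [trajInput, hss.traj_feedforward, mulVec_add]
    simp only [feedforward]
    abel
  · rw [hss.traj_feedforward, add_assoc]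
    exact hθ _ _ (S.add_mem_tube_succ hr hw)

theorem cost_feedforward (hss : S.ParametrizesSteadyStates)
    (hLyap : (S.A + S.B * S.K)ᵀ * S.P * (S.A + S.B * S.K) - S.P
      = -(S.Q + S.Kᵀ * S.R * S.K)) (x : Fin p → ℝ) (θ : Fin m → ℝ) :
    S.cost x (fun _ => S.feedforward θ) θ
      = quadForm S.P (x - S.Λ *ᵥ θ) + quadForm S.T (S.xs - S.Λ *ᵥ θ) := by
  rw [S.cost_restrict x (fun _ => S.feedforward θ) θ]
  simp only [trajInput_sub_feedforward (v := fun _ => S.feedforward θ) rfl, hss.traj_feedforward,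
    add_sub_cancel_left, sum_quadForm_closedLoop hLyap]
  ring

/-- Recursive feasibility with slack: the shifted constraint at time `i` is tightened by `tube i`,
while the old plan satisfies the one for `tube (i + 1)`. The difference of the two tubes pays for
`w`. -/
theorem feasible_shift [NeZero N] (hss : S.ParametrizesSteadyStates)
    (hcs : S.ConstraintSatisfaction)
    (hinv : S.DisturbanceInvariant) (h0 : 0 ∈ S.𝒲) {x w : Fin p → ℝ} {v : ℕ → Fin m → ℝ}
    {θ : Fin m → ℝ} (hv : v N = S.feedforward θ) (hw : w ∈ S.𝒲)
    (hw' : S.closedLoop *ᵥ w ∈ S.𝒲) (h : S.IsFeasible x (fun i => v i) θ) :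
    S.IsFeasible (S.traj x v 1 + w) (fun i => v (i + 1)) θ := by
  obtain ⟨hcon, hter⟩ := (S.isFeasible_restrict_iff x v θ).1 h
  have hter' : ∀ r ∈ S.tube (N + 1), (S.traj x v (N + 1) + r, θ) ∈ S.Ω := by
    intro r hr
    obtain ⟨r', hr', w', hw', rfl⟩ := S.exists_of_mem_tube_succ hr
    convert hinv.step_mem hss (hter r' hr') hw' using 2
    rw [hss.traj_succ_of_eq hv, add_sub_right_comm, mulVec_add]
    abel
  have hN : N ≠ 0 := NeZero.ne N
  refine (S.isFeasible_restrict_iff _ (fun i => v (i + 1)) θ).2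
    ⟨fun i hi => ⟨fun r hr => ?_, fun r hr => ?_⟩, fun r hr => ?_⟩
  · rw [traj_add, traj_shift, add_assoc]
    rcases (Nat.succ_le_of_lt hi).lt_or_eq with hi' | rfl
    · refine (hcon (i + 1) hi').1 _ ?_
      rw [pow_succ, ← mulVec_mulVec]
      exact S.add_mem_tube_succ hr hw'
    -- The last state lies beyond the old horizon, so its constraint comes from the terminal set at
    -- time `N + 1`.
    · exact (hcs (hter' _ (S.add_mem_tube_succ (S.mem_tube_succ_of_mem h0 hr) hw))).1
  · have key : S.trajInput (S.traj x v 1 + w) (fun i => v (i + 1)) i + S.K *ᵥ r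
        = S.trajInput x v (i + 1) + S.K *ᵥ (S.closedLoop ^ i *ᵥ w + r) := by
      simp only [trajInput, traj_add, traj_shift, mulVec_add]
      abel
    rw [key]
    rcases (Nat.succ_le_of_lt hi).lt_or_eq with hi' | rfl
    · exact (hcon (i + 1) hi').2 _ (S.add_mem_tube_succ hr hw)
    -- The appended input is the terminal controller's, admissible by the terminal constraint at
    -- time `N`.
    · convert (hcs (hter _ (S.add_mem_tube_succ hr hw))).2.2.1 using 1
      simp only [trajInput, Nat.succ_eq_add_one, hv, feedforward, mulVec_add]
      abel
  · rw [traj_add, traj_shift, add_assoc]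
    exact hter' _ (S.add_mem_tube_succ hr hw)

/-- The appended stage cost cancels against the change of the terminal cost, so what is saved is the
first stage cost; its input part is dropped. -/
theorem cost_shift (hss : S.ParametrizesSteadyStates) (hR : S.R.PosDef)
    (hLyap : (S.A + S.B * S.K)ᵀ * S.P * (S.A + S.B * S.K) - S.P
      = -(S.Q + S.Kᵀ * S.R * S.K)) {x : Fin p → ℝ} {v : ℕ → Fin m → ℝ}
    {θ : Fin m → ℝ} (hv : v N = S.feedforward θ) :
    S.cost (S.traj x v 1) (fun i => v (i + 1)) θ
      ≤ S.cost x (fun i => v i) θ - quadForm S.Q (x - S.Λ *ᵥ θ) := by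
  have hu : ∀ i, S.trajInput (S.traj x v 1) (fun i => v (i + 1)) i = S.trajInput x v (i + 1) :=
    fun i => by simp only [trajInput, traj_shift]
  rw [S.cost_restrict _ (fun i => v (i + 1)) θ, S.cost_restrict x v θ]
  simp only [traj_shift, hu]
  have h1 := Finset.sum_range_succ (fun i => quadForm S.Q (S.traj x v i - S.Λ *ᵥ θ) +
    quadForm S.R (S.trajInput x v i - S.Ψ *ᵥ θ)) N
  have h2 := Finset.sum_range_succ' (fun i => quadForm S.Q (S.traj x v i - S.Λ *ᵥ θ) +
    quadForm S.R (S.trajInput x v i - S.Ψ *ᵥ θ)) N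
  have h3 := quadForm_closedLoop hLyap (S.traj x v N - S.Λ *ᵥ θ)
  have h4 := quadForm_nonneg hR (S.trajInput x v 0 - S.Ψ *ᵥ θ)
  rw [trajInput_sub_feedforward hv, h3] at h1
  rw [hss.traj_succ_of_eq hv, add_sub_cancel_left]
  simp only [traj_zero] at h2
  linarith

/-! ### Convexity of the optimization problem -/

theorem predState_combo {a b : ℝ} (x y : Fin p → ℝ) (c d : Fin N → Fin m → ℝ) {i : ℕ}
    (hi : i ≤ N) :
    S.predState (a • x + b • y) (a • c + b • d) i
      = a • S.predState x c i + b • S.predState y d i := by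
  obtain ⟨v, rfl, -⟩ := S.exists_restrict_eq c 0
  obtain ⟨w, rfl, -⟩ := S.exists_restrict_eq d 0
  rw [predState_eq _ _ _ hi, predState_eq _ _ _ hi, ← traj_combo]
  exact S.predState_eq _ (a • v + b • w) hi

theorem predInput_combo {a b : ℝ} (x y : Fin p → ℝ) (c d : Fin N → Fin m → ℝ) (i : Fin N) :
    S.predInput (a • x + b • y) (a • c + b • d) i
      = a • S.predInput x c i + b • S.predInput y d i := by
  simp only [predInput, predState_combo _ _ _ _ i.2.le, Pi.add_apply, Pi.smul_apply, mulVec_add,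
    mulVec_smul, smul_add]
  abel

theorem IsFeasible.combo (hX : Convex ℝ S.𝒳) (hU : Convex ℝ S.𝒰) (hΩ : Convex ℝ S.Ω)
    {x y : Fin p → ℝ} {c d : Fin N → Fin m → ℝ} {θ η : Fin m → ℝ} (h : S.IsFeasible x c θ)
    (h' : S.IsFeasible y d η) {a b : ℝ} (ha : 0 ≤ a) (hb : 0 ≤ b) (hab : a + b = 1) :
    S.IsFeasible (a • x + b • y) (a • c + b • d) (a • θ + b • η) := by
  refine ⟨fun i => ⟨?_, ?_⟩, ?_⟩
  · rw [predState_combo _ _ _ _ (Nat.succ_le_of_lt i.2)]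
    exact convex_pontryaginDiff hX _ (h.1 i).1 (h'.1 i).1 ha hb hab
  · rw [predInput_combo]
    exact convex_pontryaginDiff hU _ (h.1 i).2 (h'.1 i).2 ha hb hab
  · rw [predState_combo _ _ _ _ le_rfl]
    exact convex_pontryaginDiff hΩ _ h.2 h'.2 ha hb hab

/-- Strong convexity of the cost, keeping only two of the quadratic terms. -/
theorem cost_combo_le [NeZero N] (hP : S.P.PosDef) (hQ : S.Q.PosDef) (hR : S.R.PosDef)
    (x y : Fin p → ℝ) (c d : Fin N → Fin m → ℝ) (θ η : Fin m → ℝ)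
    {a b : ℝ} (ha : 0 ≤ a) (hb : 0 ≤ b) (hab : a + b = 1) :
    S.cost (a • x + b • y) (a • c + b • d) (a • θ + b • η)
      ≤ a * S.cost x c θ + b * S.cost y d η - a * b * (quadForm S.T (S.Λ *ᵥ θ - S.Λ *ᵥ η) +
        quadForm S.R (S.predInput x c 0 - S.Ψ *ᵥ θ - (S.predInput y d 0 - S.Ψ *ᵥ η))) := by
  have hcombo : ∀ {k l : ℕ} (M : Matrix (Fin k) (Fin k) ℝ) (F : Matrix (Fin k) (Fin l) ℝ)
      (u v : Fin k → ℝ) (s t : Fin l → ℝ),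
      quadForm M (a • u + b • v - F *ᵥ (a • s + b • t)) = a * quadForm M (u - F *ᵥ s) +
        b * quadForm M (v - F *ᵥ t) - a * b * quadForm M (u - F *ᵥ s - (v - F *ᵥ t)) := by
    intro k l M F u v s t
    rw [← quadForm_combo M hab, mulVec_add, mulVec_smul, mulVec_smul]
    congr 1
    module
  have hab' : 0 ≤ a * b := mul_nonneg ha hb
  have h1 : S.xs = a • S.xs + b • S.xs := by rw [← add_smul, hab, one_smul]
  have hT : quadForm S.T (S.xs - S.Λ *ᵥ (a • θ + b • η)) = a * quadForm S.T (S.xs - S.Λ *ᵥ θ) +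
      b * quadForm S.T (S.xs - S.Λ *ᵥ η) - a * b * quadForm S.T (S.Λ *ᵥ θ - S.Λ *ᵥ η) := by
    have h2 : quadForm S.T (S.Λ *ᵥ θ - S.Λ *ᵥ η)
        = quadForm S.T (S.xs - S.Λ *ᵥ θ - (S.xs - S.Λ *ᵥ η)) := by
      rw [sub_sub_sub_cancel_left, ← neg_sub, ← neg_one_smul ℝ, quadForm_smul]
      norm_num
    rw [h2]
    conv_lhs => rw [h1]
    exact hcombo S.T S.Λ S.xs S.xs θ η
  simp only [cost, hT, predState_combo _ _ _ _ le_rfl, predInput_combo, hcombo,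
    predState_combo _ _ _ _ (Fin.is_lt _).le, Finset.sum_add_distrib, Finset.sum_sub_distrib,
    ← Finset.mul_sum]
  have h3 := mul_nonneg hab' (quadForm_nonneg hP
    (S.predState x c N - S.Λ *ᵥ θ - (S.predState y d N - S.Λ *ᵥ η)))
  have h4 := mul_nonneg hab' (Finset.sum_nonneg fun (i : Fin N) (_ : i ∈ Finset.univ) =>
    quadForm_nonneg hQ (S.predState x c i - S.Λ *ᵥ θ - (S.predState y d i - S.Λ *ᵥ η)))
  have h5 := mul_le_mul_of_nonneg_left (Finset.single_le_sum
    (f := fun i : Fin N => quadForm S.R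
      (S.predInput x c i - S.Ψ *ᵥ θ - (S.predInput y d i - S.Ψ *ᵥ η)))
    (fun i _ => quadForm_nonneg hR _) (Finset.mem_univ 0)) hab'
  linarith

theorem cost_nonneg (hP : S.P.PosDef) (hQ : S.Q.PosDef) (hR : S.R.PosDef) (hT : S.T.PosDef)
    (x : Fin p → ℝ) (c : Fin N → Fin m → ℝ) (θ : Fin m → ℝ) : 0 ≤ S.cost x c θ :=
  add_nonneg (add_nonneg (quadForm_nonneg hP _) (quadForm_nonneg hT _))
    (Finset.sum_nonneg fun _ _ => add_nonneg (quadForm_nonneg hQ _) (quadForm_nonneg hR _))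

theorem le_cost [NeZero N] (hP : S.P.PosDef) (hQ : S.Q.PosDef) (hR : S.R.PosDef)
    (x : Fin p → ℝ) (c : Fin N → Fin m → ℝ) (θ : Fin m → ℝ) :
    quadForm S.Q (x - S.Λ *ᵥ θ) + quadForm S.T (S.xs - S.Λ *ᵥ θ) ≤ S.cost x c θ := by
  have h := Finset.single_le_sum (f := fun i : Fin N =>
      quadForm S.Q (S.predState x c i - S.Λ *ᵥ θ) + quadForm S.R (S.predInput x c i - S.Ψ *ᵥ θ))
    (fun i _ => add_nonneg (quadForm_nonneg hQ _) (quadForm_nonneg hR _)) (Finset.mem_univ 0)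
  have h1 := quadForm_nonneg hP (S.predState x c N - S.Λ *ᵥ θ)
  have h2 := quadForm_nonneg hR (S.predInput x c 0 - S.Ψ *ᵥ θ)
  have h3 : S.predState x c (0 : Fin N) = x := rfl
  simp only [h3] at h
  rw [cost]
  linarith

/-- The midpoint of two minimizers would be cheaper unless `Λ θ` and the first input deviation `ǔ_0
- Ψ θ` agree. The steady-state equation recovers `B Ψ θ` from `Λ θ`, hence `B ǔ_0` agrees;
uniqueness of `ǔ_0` itself is not needed. -/
theorem IsMinimizer.successor_unique [NeZero N] (hss : S.ParametrizesSteadyStates)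
    (hX : Convex ℝ S.𝒳) (hU : Convex ℝ S.𝒰) (hΩ : Convex ℝ S.Ω)
    (hP : S.P.PosDef) (hQ : S.Q.PosDef) (hR : S.R.PosDef) (hT : S.T.PosDef)
    {x : Fin p → ℝ} {c d : Fin N → Fin m → ℝ} {θ η : Fin m → ℝ}
    (h : S.IsMinimizer x c θ) (h' : S.IsMinimizer x d η) :
    S.A *ᵥ x + S.B *ᵥ (S.K *ᵥ x + c 0) = S.A *ᵥ x + S.B *ᵥ (S.K *ᵥ x + d 0) := by
  have ha : (0 : ℝ) ≤ 2⁻¹ := by norm_num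
  have hab : (2⁻¹ : ℝ) + 2⁻¹ = 1 := by norm_num
  have hf := h.1.combo hX hU hΩ h'.1 ha ha hab
  have hc := cost_combo_le hP hQ hR x x c d θ η ha ha hab
  rw [← add_smul, hab, one_smul] at hf hc
  have h1 := h.2 _ _ hf
  have h2 := h.2 _ _ h'.1
  have h3 := h'.2 _ _ h.1
  have h4 := quadForm_nonneg hT (S.Λ *ᵥ θ - S.Λ *ᵥ η)
  have h5 := quadForm_nonneg hR
    (S.predInput x c 0 - S.Ψ *ᵥ θ - (S.predInput x d 0 - S.Ψ *ᵥ η))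
  have h6 : S.Λ *ᵥ θ = S.Λ *ᵥ η := by
    by_contra hne
    have := quadForm_pos hT (sub_ne_zero.2 hne)
    linarith
  have h7 : S.predInput x c 0 - S.Ψ *ᵥ θ = S.predInput x d 0 - S.Ψ *ᵥ η := by
    by_contra hne
    have := quadForm_pos hR (sub_ne_zero.2 hne)
    linarith
  have h8 : S.B *ᵥ (S.Ψ *ᵥ θ) = S.B *ᵥ (S.Ψ *ᵥ η) := by
    have e := hss.steady θ
    rw [h6] at e
    exact add_left_cancel (e.trans (hss.steady η).symm)
  have h9 := congrArg (S.B *ᵥ ·) h7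
  simp only [mulVec_sub, h8, sub_left_inj] at h9
  exact congrArg (S.A *ᵥ x + ·) h9

/-! ### Existence of minimizers -/

theorem continuous_cost (S : LinearMPC p m N) (x : Fin p → ℝ) :
    Continuous fun z : (Fin N → Fin m → ℝ) × (Fin m → ℝ) => S.cost x z.1 z.2 := by
  have h1 := fun i => (S.continuous_predState x i).comp
    (continuous_fst (X := Fin N → Fin m → ℝ) (Y := Fin m → ℝ))
  have h2 := fun i => (S.continuous_predInput x i).comp
    (continuous_fst (X := Fin N → Fin m → ℝ) (Y := Fin m → ℝ))
  simp only [Function.comp_def] at h1 h2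
  have hP := continuous_quadForm S.P
  have hQ := continuous_quadForm S.Q
  have hR := continuous_quadForm S.R
  have hT := continuous_quadForm S.T
  unfold cost
  fun_prop

theorem isClosed_feasible (hX : IsClosed S.𝒳) (hU : IsClosed S.𝒰) (hΩ : IsClosed S.Ω)
    (x : Fin p → ℝ) :
    IsClosed {z : (Fin N → Fin m → ℝ) × (Fin m → ℝ) | S.IsFeasible x z.1 z.2} := by
  have h1 := fun i => (S.continuous_predState x i).comp
    (continuous_fst (X := Fin N → Fin m → ℝ) (Y := Fin m → ℝ))
  have h2 := fun i => (S.continuous_predInput x i).comp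
    (continuous_fst (X := Fin N → Fin m → ℝ) (Y := Fin m → ℝ))
  have h3 : IsClosed (⋂ i : Fin N,
      (fun z : (Fin N → Fin m → ℝ) × (Fin m → ℝ) => S.predState x z.1 (i + 1)) ⁻¹'
        pontryaginDiff S.𝒳 (S.tube i) ∩ (fun z => S.predInput x z.1 i) ⁻¹'
        pontryaginDiff S.𝒰 ((fun r => S.K *ᵥ r) '' S.tube i)) :=
    isClosed_iInter fun i => ((isClosed_pontryaginDiff hX _).preimage (h1 (i + 1))).inter
      ((isClosed_pontryaginDiff hU _).preimage (h2 i))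
  convert h3.inter ((isClosed_pontryaginDiff hΩ (S.tube N ×ˢ {0})).preimage
    ((h1 N).prodMk continuous_snd)) using 1
  ext z
  simp [IsFeasible]

theorem IsFeasible.predState_mem (h0 : 0 ∈ S.𝒲) {x : Fin p → ℝ} {c : Fin N → Fin m → ℝ}
    {θ : Fin m → ℝ} (h : S.IsFeasible x c θ) {i : ℕ} (hi : i < N) :
    S.predState x c (i + 1) ∈ S.𝒳 := by
  simpa using (h.1 ⟨i, hi⟩).1 0 (S.zero_mem_tube h0 _)

theorem IsFeasible.predState_eq_or_mem (h0 : 0 ∈ S.𝒲) {x : Fin p → ℝ}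
    {c : Fin N → Fin m → ℝ} {θ : Fin m → ℝ} (h : S.IsFeasible x c θ) {i : ℕ} (hi : i ≤ N) :
    S.predState x c i = x ∨ S.predState x c i ∈ S.𝒳 := by
  cases i with
  | zero => exact Or.inl rfl
  | succ i => exact Or.inr (h.predState_mem h0 hi)

theorem IsFeasible.predInput_mem (h0 : 0 ∈ S.𝒲) {x : Fin p → ℝ} {c : Fin N → Fin m → ℝ}
    {θ : Fin m → ℝ} (h : S.IsFeasible x c θ) (i : Fin N) : S.predInput x c i ∈ S.𝒰 := by
  simpa using (h.1 i).2 0 ⟨0, S.zero_mem_tube h0 _, by simp⟩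

/-- Each `c i` is an input minus `K` times a state, both in compact sets. The terminal set confines
`(Λ θ, Ψ θ)` to `𝒳 × 𝒰`, which bounds `θ` because the parametrization is injective. -/
theorem isCompact_feasible (hss : S.ParametrizesSteadyStates) (hcs : S.ConstraintSatisfaction)
    (hX : IsCompact S.𝒳) (hU : IsCompact S.𝒰) (hΩ : IsClosed S.Ω) (h0 : 0 ∈ S.𝒲)
    (x : Fin p → ℝ) :
    IsCompact {z : (Fin N → Fin m → ℝ) × (Fin m → ℝ) | S.IsFeasible x z.1 z.2} := by
  -- The initial state is not constrained to `𝒳`, so it is inserted.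
  have h1 : IsCompact ((fun z : (Fin p → ℝ) × (Fin m → ℝ) => z.2 - S.K *ᵥ z.1) ''
      (insert x S.𝒳 ×ˢ S.𝒰)) :=
    ((hX.insert x).prod hU).image (by fun_prop)
  let L : (Fin m → ℝ) →ₗ[ℝ] (Fin p → ℝ) × (Fin m → ℝ) := S.Λ.mulVecLin.prod S.Ψ.mulVecLin
  have hL : Function.Injective L := by
    intro θ η h
    refine hss.injective ?_
    have h' := Prod.ext_iff.1 h
    simp only [L, LinearMap.prod_apply, Function.prod_apply, mulVecLin_apply] at h'
    rw [mulVecLin_apply, mulVecLin_apply, fromRows_mulVec, fromRows_mulVec, h'.1, h'.2]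
  have h2 : IsCompact (L ⁻¹' (S.𝒳 ×ˢ S.𝒰)) :=
    (LinearMap.isClosedEmbedding_of_injective (LinearMap.ker_eq_bot.2 hL)).isCompact_preimage
      (hX.prod hU)
  refine ((isCompact_univ_pi fun _ : Fin N => h1).prod h2).of_isClosed_subset
    (isClosed_feasible hX.isClosed hU.isClosed hΩ x) ?_
  rintro ⟨c, θ⟩ (h : S.IsFeasible x c θ)
  have hter := hcs (terminal_mem h0 h)
  refine ⟨fun i _ => ⟨(S.predState x c i, S.predInput x c i),
    ⟨?_, h.predInput_mem h0 i⟩, ?_⟩, hter.2.1, hter.2.2.2⟩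
  · exact h.predState_eq_or_mem h0 i.2.le
  · simp [predInput]

theorem exists_isMinimizer (hss : S.ParametrizesSteadyStates) (hcs : S.ConstraintSatisfaction)
    (hX : IsCompact S.𝒳) (hU : IsCompact S.𝒰) (hΩ : IsClosed S.Ω) (h0 : 0 ∈ S.𝒲)
    {x : Fin p → ℝ} (hx : x ∈ S.feasibleRegion) : ∃ c θ, S.IsMinimizer x c θ := by
  obtain ⟨c₀, θ₀, h₀⟩ := hx
  obtain ⟨z, hz, hmin⟩ := (isCompact_feasible hss hcs hX hU hΩ h0 x).exists_isMinOn
    ⟨(c₀, θ₀), h₀⟩ (S.continuous_cost x).continuousOn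
  exact ⟨z.1, z.2, hz, fun c θ h => hmin (a := (c, θ)) h⟩

/-! ### The value function -/

/-- The optimal cost at `x`. -/
noncomputable def value (S : LinearMPC p m N) (x : Fin p → ℝ) : ℝ :=
  sInf {r | ∃ c θ, S.IsFeasible x c θ ∧ S.cost x c θ = r}

theorem IsMinimizer.value_eq {x : Fin p → ℝ} {c : Fin N → Fin m → ℝ} {θ : Fin m → ℝ}
    (h : S.IsMinimizer x c θ) : S.value x = S.cost x c θ := by
  refine IsLeast.csInf_eq ⟨⟨c, θ, h.1, rfl⟩, ?_⟩
  rintro _ ⟨c', θ', h', rfl⟩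
  exact h.2 c' θ' h'

theorem value_le (hP : S.P.PosDef) (hQ : S.Q.PosDef) (hR : S.R.PosDef) (hT : S.T.PosDef)
    {x : Fin p → ℝ} {c : Fin N → Fin m → ℝ} {θ : Fin m → ℝ} (h : S.IsFeasible x c θ) :
    S.value x ≤ S.cost x c θ := by
  refine csInf_le ⟨0, ?_⟩ ⟨c, θ, h, rfl⟩
  rintro _ ⟨c', θ', -, rfl⟩
  exact cost_nonneg hP hQ hR hT _ _ _

/-- Partial minimization of a jointly convex problem; this is the source of continuity in the
interior. -/
theorem convexOn_value [NeZero N] (hX : Convex ℝ S.𝒳) (hU : Convex ℝ S.𝒰) (hΩ : Convex ℝ S.Ω)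
    (hP : S.P.PosDef) (hQ : S.Q.PosDef) (hR : S.R.PosDef) (hT : S.T.PosDef)
    (hmin : ∀ x ∈ S.feasibleRegion, ∃ c θ, S.IsMinimizer x c θ) :
    ConvexOn ℝ S.feasibleRegion S.value := by
  refine ⟨?_, ?_⟩
  · rintro x ⟨c, θ, h⟩ y ⟨d, η, h'⟩ a b ha hb hab
    exact ⟨_, _, h.combo hX hU hΩ h' ha hb hab⟩
  · intro x hx y hy a b ha hb hab
    obtain ⟨c, θ, h⟩ := hmin x hx
    obtain ⟨d, η, h'⟩ := hmin y hy
    rw [h.value_eq, h'.value_eq]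
    refine (value_le hP hQ hR hT (h.1.combo hX hU hΩ h'.1 ha hb hab)).trans ?_
    refine (cost_combo_le hP hQ hR x y c d θ η ha hb hab).trans (sub_le_self _ ?_)
    exact mul_nonneg (mul_nonneg ha hb) (add_nonneg (quadForm_nonneg hT _) (quadForm_nonneg hR _))

/-- Every quantity in the cost is confined to a bounded set except the initial state, which enters
only through the first stage cost; hence the quadratic growth. -/
theorem exists_cost_le (hcs : S.ConstraintSatisfaction) (hX : IsCompact S.𝒳)
    (hU : IsCompact S.𝒰) (h0 : 0 ∈ S.𝒲) (hxs : S.xs ∈ S.𝒳) (hN : N ≠ 0) :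
    ∃ a ≥ 0, ∃ b ≥ 0, ∀ x c θ, S.IsFeasible x c θ → S.cost x c θ ≤ a + b * ‖x - S.xs‖ ^ 2 := by
  obtain ⟨ρ₁, hρ₁⟩ := hX.isBounded.exists_norm_le
  obtain ⟨ρ₂, hρ₂⟩ := hU.isBounded.exists_norm_le
  obtain ⟨CP, hCP0, hCP⟩ := exists_quadForm_le S.P
  obtain ⟨CQ, hCQ0, hCQ⟩ := exists_quadForm_le S.Q
  obtain ⟨CR, hCR0, hCR⟩ := exists_quadForm_le S.R
  obtain ⟨CT, hCT0, hCT⟩ := exists_quadForm_le S.T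
  refine ⟨CP * (2 * ρ₁) ^ 2 + CT * (2 * ρ₁) ^ 2 + N * (CQ * (2 * (2 * ρ₁) ^ 2) +
    CR * (2 * ρ₂) ^ 2), by positivity, N * (CQ * 2), by positivity, fun x c θ h => ?_⟩
  have hΛ := hρ₁ _ (hcs (terminal_mem h0 h)).2.1
  have hΨ := hρ₂ _ (hcs (terminal_mem h0 h)).2.2.2
  have hs := hρ₁ _ hxs
  have bound : ∀ {k : ℕ} {ρ : ℝ} {u v : Fin k → ℝ}, ‖u‖ ≤ ρ → ‖v‖ ≤ ρ →
      ‖u - v‖ ^ 2 ≤ (2 * ρ) ^ 2 := by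
    intro k ρ u v hu hv
    have := norm_sub_le u v
    gcongr
    linarith
  -- `N ≠ 0` ensures that the terminal state is not the unconstrained initial state.
  have hter : S.predState x c N ∈ S.𝒳 := by
    obtain ⟨n, rfl⟩ := Nat.exists_eq_succ_of_ne_zero hN
    exact h.predState_mem h0 n.lt_succ_self
  have hsum : ∀ i ∈ (Finset.univ : Finset (Fin N)),
      quadForm S.Q (S.predState x c i - S.Λ *ᵥ θ) + quadForm S.R (S.predInput x c i - S.Ψ *ᵥ θ)
      ≤ CQ * (2 * ‖x - S.xs‖ ^ 2 + 2 * (2 * ρ₁) ^ 2) + CR * (2 * ρ₂) ^ 2 := by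
    intro i _
    refine add_le_add ((hCQ _).trans ?_) ((hCR _).trans ?_)
    · refine mul_le_mul_of_nonneg_left ?_ hCQ0.le
      rcases h.predState_eq_or_mem h0 i.2.le with h' | h'
      · have h1 : ‖x - S.Λ *ᵥ θ‖ ≤ ‖x - S.xs‖ + ‖S.xs - S.Λ *ᵥ θ‖ :=
          norm_sub_le_norm_sub_add_norm_sub ..
        have h2 := bound hs hΛ
        have h3 : ‖x - S.Λ *ᵥ θ‖ ^ 2 ≤ (‖x - S.xs‖ + ‖S.xs - S.Λ *ᵥ θ‖) ^ 2 := by gcongr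
        rw [h']
        linarith [sq_nonneg (‖x - S.xs‖ - ‖S.xs - S.Λ *ᵥ θ‖)]
      · have h1 := bound (hρ₁ _ h') hΛ
        linarith [sq_nonneg ‖x - S.xs‖, sq_nonneg (2 * ρ₁)]
    · exact mul_le_mul_of_nonneg_left (bound (hρ₂ _ (h.predInput_mem h0 i)) hΨ) hCR0.le
  have h1 := Finset.sum_le_sum hsum
  rw [Finset.sum_const, Finset.card_univ, Fintype.card_fin, nsmul_eq_mul] at h1
  have h2 := (hCP (S.predState x c N - S.Λ *ᵥ θ)).trans
    (mul_le_mul_of_nonneg_left (bound (hρ₁ _ hter) hΛ) hCP0.le)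
  have h3 := (hCT (S.xs - S.Λ *ᵥ θ)).trans (mul_le_mul_of_nonneg_left (bound hs hΛ) hCT0.le)
  rw [cost]
  linarith

/-- The stage cost at a minimizer controls the distance to the target: otherwise moving the
artificial steady state towards the target would lower the cost. -/
theorem exists_le_quadForm_of_isMinimizer [NeZero N] (hss : S.ParametrizesSteadyStates)
    (hcs : S.ConstraintSatisfaction) (hX : IsCompact S.𝒳) (hΩ : Convex ℝ S.Ω) (h0 : 0 ∈ S.𝒲)
    (hP : S.P.PosDef) (hQ : S.Q.PosDef) (hR : S.R.PosDef) (hT : S.T.PosDef)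
    (hLyap : (S.A + S.B * S.K)ᵀ * S.P * (S.A + S.B * S.K) - S.P
      = -(S.Q + S.Kᵀ * S.R * S.K))
    (hadm : ∀ x θ, (x, θ) ∈ S.Ω → S.IsAdmissible θ)
    {θs : Fin m → ℝ} (hθs : S.xs = S.Λ *ᵥ θs) (hθsX : S.xs ∈ S.𝒳) (hθsadm : S.IsAdmissible θs)
    {ε : ℝ} (hε : 0 < ε) (hball : ∀ w, ‖w‖ ≤ ε → w ∈ S.𝒲 ∧ S.closedLoop *ᵥ w ∈ S.𝒲) :
    ∃ κ > 0, ∀ x c θ, S.IsMinimizer x c θ →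
      κ * ‖x - S.xs‖ ^ 2 ≤ quadForm S.Q (x - S.Λ *ᵥ θ) := by
  obtain ⟨ρ, hρ0, hρ⟩ := hX.isBounded.exists_pos_norm_le
  obtain ⟨C, hC0, hC⟩ := exists_quadForm_le S.P
  obtain ⟨q, hq0, hq⟩ := exists_le_quadForm hQ
  obtain ⟨t, ht0, ht⟩ := exists_le_quadForm hT
  -- `β` is the fraction by which `θ` moves towards `θs`. The bound `t / (4 * C)` lets the gain in
  -- the `T` term absorb the loss of order `β ^ 2` in the `P` term; the bound with `ε` keeps the
  -- candidate feasible, given `‖D‖ ≤ 2 * ρ`.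
  obtain ⟨β, hβ0, hβ1, hβ2, hβ3⟩ :
      ∃ β > 0, β ≤ 1 ∧ β ≤ t / (4 * C) ∧ β ≤ ε / (2 * (2 * ρ)) :=
    ⟨min 1 (min (t / (4 * C)) (ε / (2 * (2 * ρ)))), by positivity, min_le_left _ _,
      (min_le_right _ _).trans (min_le_left _ _), (min_le_right _ _).trans (min_le_right _ _)⟩
  rw [le_div_iff₀ (by positivity)] at hβ2 hβ3
  obtain ⟨L, hL0, hL1, hL2⟩ : ∃ L > 0, 4 * C / (β * t) ≤ L ∧ (2 * (2 * ρ) / ε) ^ 2 ≤ L :=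
    ⟨max (4 * C / (β * t)) ((2 * (2 * ρ) / ε) ^ 2), by positivity, le_max_left _ _,
      le_max_right _ _⟩
  refine ⟨q / (2 + 2 * L), by positivity, fun x c θ h => ?_⟩
  obtain ⟨e, he⟩ : ∃ e, e = x - S.Λ *ᵥ θ := ⟨_, rfl⟩
  obtain ⟨D, hD⟩ : ∃ D, D = S.xs - S.Λ *ᵥ θ := ⟨_, rfl⟩
  have hDρ : ‖D‖ ≤ 2 * ρ := by
    rw [hD]
    linarith [norm_sub_le S.xs (S.Λ *ᵥ θ), hρ _ hθsX, hρ _ (hcs (terminal_mem h0 h.1)).2.1]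
  have hDe : ‖D‖ ^ 2 ≤ L * ‖e‖ ^ 2 := by
    by_cases hsmall : ‖e‖ ≤ ε / 2
    · have hβD : ‖e - β • D‖ ≤ ‖e‖ + β * ‖D‖ := by
        simpa [norm_smul, abs_of_pos hβ0] using norm_sub_le e (β • D)
      have hβDε : β * ‖D‖ ≤ ε / 2 := by
        have := mul_le_mul_of_nonneg_left hDρ hβ0.le
        linarith
      have hx' : x - S.Λ *ᵥ ((1 - β) • θ + β • θs) = e - β • D := by
        rw [he, hD, hθs, mulVec_add, mulVec_smul, mulVec_smul]
        module
      have hs' : S.xs - S.Λ *ᵥ ((1 - β) • θ + β • θs) = (1 - β) • D := by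
        rw [hD, mulVec_add, mulVec_smul, mulVec_smul, ← hθs]
        module
      have hadm' := (hadm _ _ (terminal_mem h0 h.1)).combo hΩ hθsadm
        (a := 1 - β) (b := β) (by linarith) hβ0.le (by ring)
      have hb := hball (x - S.Λ *ᵥ ((1 - β) • θ + β • θs)) (by rw [hx']; linarith)
      -- Optimality against the moved steady state: `Q(e) + T(D) ≤ P(e - β D) + (1 - β)² T(D)`.
      have hle := (le_cost hP hQ hR x c θ).trans
        (h.2 _ _ (feasible_feedforward hss hcs hadm' hb.1 hb.2))
      rw [cost_feedforward hss hLyap, hx', hs', quadForm_smul, ← he, ← hD] at hle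
      have h1 : quadForm S.P (e - β • D) ≤ C * (2 * ‖e‖ ^ 2 + 2 * (β * ‖D‖) ^ 2) := by
        refine (hC _).trans (mul_le_mul_of_nonneg_left ?_ hC0.le)
        have : ‖e - β • D‖ ^ 2 ≤ (‖e‖ + β * ‖D‖) ^ 2 := by gcongr
        linarith [sq_nonneg (‖e‖ - β * ‖D‖)]
      have h2 : β * (t * ‖D‖ ^ 2) ≤ (1 - (1 - β) ^ 2) * quadForm S.T D := by
        refine mul_le_mul ?_ (ht D) (by positivity) ?_ <;> nlinarith
      have h3 : β * ‖D‖ ^ 2 * (β * (4 * C)) ≤ β * ‖D‖ ^ 2 * t := by gcongr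
      have h4 := quadForm_nonneg hQ e
      have h5 : ‖D‖ ^ 2 * (β * t) ≤ 4 * C * ‖e‖ ^ 2 := by linarith
      calc ‖D‖ ^ 2 ≤ 4 * C * ‖e‖ ^ 2 / (β * t) := (le_div_iff₀ (by positivity)).2 h5
        _ = 4 * C / (β * t) * ‖e‖ ^ 2 := by ring
        _ ≤ L * ‖e‖ ^ 2 := by gcongr
    -- When `e` is not small, boundedness of `D` is enough.
    · push Not at hsmall
      calc ‖D‖ ^ 2 ≤ (2 * ρ) ^ 2 := by gcongr
        _ = (2 * (2 * ρ) / ε) ^ 2 * (ε / 2) ^ 2 := by field_simp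
        _ ≤ L * ‖e‖ ^ 2 := by gcongr
  have hxe : ‖x - S.xs‖ ^ 2 ≤ (2 + 2 * L) * ‖e‖ ^ 2 := by
    have h1 : x - S.xs = e - D := by rw [he, hD]; abel
    have h2 : ‖x - S.xs‖ ^ 2 ≤ (‖e‖ + ‖D‖) ^ 2 := by
      rw [h1]
      gcongr
      exact norm_sub_le _ _
    linarith [sq_nonneg (‖e‖ - ‖D‖)]
  rw [← he]
  refine le_trans ?_ (hq e)
  rw [div_mul_eq_mul_div, div_le_iff₀ (by positivity)]
  calc q * ‖x - S.xs‖ ^ 2 ≤ q * ((2 + 2 * L) * ‖e‖ ^ 2) := by gcongr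
    _ = _ := by ring

end LinearMPC

/-! ### Making a Lyapunov function continuous. -/

/-- A convex, possibly discontinuous, Lyapunov function with quadratic bounds can be replaced by a
continuous one if the map sends the domain uniformly into its interior: away from the image of
the map, the function is interpolated with a continuous upper bound. -/
theorem exists_isContinuousLyapunov_of_convexOn {p : ℕ} {D : Set (Fin p → ℝ)}
    {f : (Fin p → ℝ) → (Fin p → ℝ)} {V : (Fin p → ℝ) → ℝ} {xs : Fin p → ℝ}
    {ε κ C M : ℝ} (hε : 0 < ε) (hκ : 0 < κ) (hC : 0 < C)
    (hV : ConvexOn ℝ D V) (hxs : xs ∈ D) (hf : ∀ x ∈ D, ∀ w, ‖w‖ ≤ ε → f x + w ∈ D)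
    (hlow : ∀ x ∈ D, κ * ‖x - xs‖ ^ 2 ≤ V x) (hupp : ∀ x ∈ D, V x ≤ C * ‖x - xs‖ ^ 2)
    (hdec : ∀ x ∈ D, V (f x) ≤ V x - κ * ‖x - xs‖ ^ 2) (hM : ∀ x ∈ D, V (f x) ≤ M) :
    ∃ W : (Fin p → ℝ) → ℝ, IsContinuousLyapunov f D xs W := by
  have hmaps : Set.MapsTo f D D := fun x hx => by simpa using hf x hx 0 (by simpa using hε.le)
  have hfix : f xs = xs := by
    have h1 := hlow _ (hmaps hxs)
    have h2 := hdec xs hxs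
    have h3 := hupp xs hxs
    simp only [sub_self, norm_zero, ne_eq, OfNat.ofNat_ne_zero, not_false_eq_true, zero_pow,
      mul_zero, sub_zero] at h2 h3
    have h4 : ‖f xs - xs‖ ^ 2 ≤ 0 := by
      by_contra! h
      have := mul_pos hκ h
      linarith
    exact sub_eq_zero.1 (norm_eq_zero.1 (pow_eq_zero_iff two_ne_zero |>.1
      (le_antisymm h4 (sq_nonneg _))))
  have hM0 : 0 ≤ M := (by positivity : 0 ≤ κ * ‖f xs - xs‖ ^ 2).trans
    ((hlow _ (hmaps hxs)).trans (hM xs hxs))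
  have hne : (f '' D).Nonempty := ⟨_, Set.mem_image_of_mem f hxs⟩
  -- The blending weight vanishes on the image of `f` and reaches `1` at distance `ε / 2`, strictly
  -- before `ε`, the distance within which `V` is known to be continuous.
  let ψ : (Fin p → ℝ) → ℝ := fun x => min 1 (2 / ε * Metric.infDist x (f '' D))
  have hψ0 : ∀ x, 0 ≤ ψ x := fun x =>
    le_min zero_le_one (mul_nonneg (by positivity) Metric.infDist_nonneg)
  have hψ1 : ∀ x, ψ x ≤ 1 := fun x => min_le_left _ _
  have hψc : Continuous ψ :=
    continuous_const.min (continuous_const.mul (Metric.continuous_infDist_pt _))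
  -- The equilibrium is its own image, so the weight vanishes there at a linear rate. This tames the
  -- constant `M` in the upper bound and explains its linear term.
  have hψxs : ∀ x, ψ x ≤ 2 / ε * ‖x - xs‖ := fun x => by
    refine (min_le_right _ _).trans (mul_le_mul_of_nonneg_left ?_ (by positivity))
    rw [← dist_eq_norm]
    exact Metric.infDist_le_dist_of_mem ⟨xs, hxs, hfix⟩
  have hψf : ∀ x ∈ D, ψ (f x) = 0 := fun x hx => by
    simp [ψ, Metric.infDist_zero_of_mem (Set.mem_image_of_mem f hx)]
  obtain ⟨E, hE0, hE⟩ := exists_euclNorm_le (k := p)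
  have hκE : ∀ v : Fin p → ℝ, 0 * euclNorm v + κ / E ^ 2 * euclNorm v ^ 2 ≤ κ * ‖v‖ ^ 2 := by
    intro v
    have h1 : euclNorm v ^ 2 ≤ (E * ‖v‖) ^ 2 :=
      pow_le_pow_left₀ ((norm_nonneg v).trans (norm_le_euclNorm v)) (hE v) 2
    calc 0 * euclNorm v + κ / E ^ 2 * euclNorm v ^ 2 ≤ κ / E ^ 2 * (E * ‖v‖) ^ 2 := by
          rw [zero_mul, zero_add]
          gcongr
      _ = κ * ‖v‖ ^ 2 := by field_simp
  have hα : IsClassKInfty fun s => 0 * s + κ / E ^ 2 * s ^ 2 :=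
    isClassKInfty_linear_add_quadratic le_rfl (by positivity)
  refine ⟨fun x => (1 - ψ x) * V x + ψ x * (M + κ * ‖x - xs‖ ^ 2),
    hxs, hfix, hmaps, ?_, ⟨_, fun s => (2 / ε * M) * s + (C + κ) * s ^ 2, hα,
      isClassKInfty_linear_add_quadratic (by positivity) (by positivity), fun x hx => ⟨?_, ?_⟩⟩,
    ⟨_, hα, fun x hx => ?_⟩⟩
  · intro x hx
    refine ContinuousAt.continuousWithinAt ?_
    have hcont : Continuous fun x => M + κ * ‖x - xs‖ ^ 2 := by fun_prop
    by_cases hd : Metric.infDist x (f '' D) < ε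
    · obtain ⟨_, ⟨y, hy, rfl⟩, hxy⟩ := (Metric.infDist_lt_iff hne).1 hd
      have hint : x ∈ interior D := by
        refine mem_interior.2 ⟨Metric.ball (f y) ε, fun z hz => ?_, Metric.isOpen_ball, hxy⟩
        have h := hf y hy (z - f y) (by rw [← dist_eq_norm]; exact (Metric.mem_ball.1 hz).le)
        rwa [add_sub_cancel] at h
      have hVx : ContinuousAt V x :=
        hV.continuousOn_interior.continuousAt (isOpen_interior.mem_nhds hint)
      exact ((continuousAt_const.sub hψc.continuousAt).mul hVx).add
        (hψc.continuousAt.mul hcont.continuousAt)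
    · have hev : ∀ᶠ y in 𝓝 x, ε / 2 < Metric.infDist y (f '' D) :=
        (Metric.continuous_infDist_pt _).continuousAt.eventually_const_lt (by linarith)
      refine hcont.continuousAt.congr ?_
      filter_upwards [hev] with y hy
      have h1 : ψ y = 1 := by
        refine min_eq_left ?_
        calc (1 : ℝ) = 2 / ε * (ε / 2) := by field_simp
          _ ≤ _ := by gcongr
      simp [h1]
  · refine (hκE _).trans ?_
    have h1 := mul_le_mul_of_nonneg_left (hlow x hx) (sub_nonneg.2 (hψ1 x))
    have h2 := mul_nonneg (hψ0 x) hM0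
    linarith
  · have h1 : (1 - ψ x) * V x ≤ C * ‖x - xs‖ ^ 2 := by
      have hV0 : 0 ≤ V x := (by positivity : 0 ≤ κ * ‖x - xs‖ ^ 2).trans (hlow x hx)
      exact (mul_le_of_le_one_left hV0 (by linarith [hψ0 x])).trans (hupp x hx)
    have h2 := mul_le_mul_of_nonneg_right (hψxs x) hM0
    have h3 := mul_le_mul_of_nonneg_right (hψ1 x) (by positivity : 0 ≤ κ * ‖x - xs‖ ^ 2)
    have h4 := norm_le_euclNorm (x - xs)
    calc (1 - ψ x) * V x + ψ x * (M + κ * ‖x - xs‖ ^ 2)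
        ≤ (2 / ε * M) * ‖x - xs‖ + (C + κ) * ‖x - xs‖ ^ 2 := by linarith
      _ ≤ (2 / ε * M) * euclNorm (x - xs) + (C + κ) * euclNorm (x - xs) ^ 2 := by gcongr
  -- At `f x` the blend is `V (f x)`, which lies below `V x - κ ‖x - xs‖ ^ 2` and below `M`; weight
  -- these two bounds by `1 - ψ x` and `ψ x`.
  · have h1 := hκE (x - xs)
    have h2 := mul_le_mul_of_nonneg_left (hdec x hx) (sub_nonneg.2 (hψ1 x))
    have h3 := mul_le_mul_of_nonneg_left (hM x hx) (hψ0 x)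
    simp only [hψf x hx]
    linarith

/-! ### The closed loop. -/

theorem proposition1 {p m N : ℕ} [NeZero N] (S : LinearMPC p m N)
    (hX : IsPolytope S.𝒳) (hU : IsPolytope S.𝒰)
    (hW : IsPolytope S.𝒲) (hW0 : (0 : Fin p → ℝ) ∈ interior S.𝒲)
    (hss : S.ParametrizesSteadyStates)
    (hΩclosed : IsClosed S.Ω) (hΩconvex : Convex ℝ S.Ω)
    (hΩcs : S.ConstraintSatisfaction) (hΩinv : S.DisturbanceInvariant)
    (hP : S.P.PosDef) (hQ : S.Q.PosDef) (hR : S.R.PosDef) (hT : S.T.PosDef)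
    (hxs : ∃ θs : Fin m → ℝ, S.xs = S.Λ *ᵥ θs ∧ S.Λ *ᵥ θs ∈ S.𝒳 ∧ ∃ x, (x, θs) ∈ S.Ω)
    (hSchur : IsSchurStable (S.A + S.B * S.K))
    (hLyap : (S.A + S.B * S.K)ᵀ * S.P * (S.A + S.B * S.K) - S.P
      = -(S.Q + S.Kᵀ * S.R * S.K)) :
    ∃ f : (Fin p → ℝ) → (Fin p → ℝ),
      (∀ x ∈ S.feasibleRegion, S.successors x = {f x}) ∧
      ∃ W : (Fin p → ℝ) → ℝ, IsContinuousLyapunov f S.feasibleRegion S.xs W := by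
  obtain ⟨θs, hθs, hθsX, x₀, hx₀⟩ := hxs
  rw [← hθs] at hθsX
  have h0 : (0 : Fin p → ℝ) ∈ S.𝒲 := interior_subset hW0
  have hpow := LinearMPC.tendsto_closedLoop_pow hP hQ hR hLyap
  have hadm : ∀ x θ, (x, θ) ∈ S.Ω → S.IsAdmissible θ := fun x θ h =>
    LinearMPC.isAdmissible_of_mem hΩinv hss hΩclosed h0 hpow h
  have hθsadm := hadm _ _ hx₀
  obtain ⟨ε, hε, hball⟩ : ∃ ε > 0, ∀ w, ‖w‖ ≤ ε → w ∈ S.𝒲 ∧ S.closedLoop *ᵥ w ∈ S.𝒲 := by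
    have hc : Continuous fun w : Fin p → ℝ => S.closedLoop *ᵥ w := by fun_prop
    have h1 : S.𝒲 ∈ 𝓝 (0 : Fin p → ℝ) := mem_interior_iff_mem_nhds.1 hW0
    have h2 := hc.continuousAt.preimage_mem_nhds (x := 0) (t := S.𝒲) (by simpa using h1)
    obtain ⟨ε, hε, h⟩ := Metric.nhds_basis_closedBall.mem_iff.1 (inter_mem h1 h2)
    exact ⟨ε, hε, fun w hw => h (by simpa using hw)⟩
  have hmin := fun x (hx : x ∈ S.feasibleRegion) =>
    LinearMPC.exists_isMinimizer hss hΩcs hX.isCompact hU.isCompact hΩclosed h0 hx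
  choose! c θ hcθ using hmin
  obtain ⟨κ, hκ, hkey⟩ := LinearMPC.exists_le_quadForm_of_isMinimizer hss hΩcs hX.isCompact
    hΩconvex h0 hP hQ hR hT hLyap hadm hθs hθsX hθsadm hε hball
  obtain ⟨a, ha, b, hb, hcost⟩ :=
    LinearMPC.exists_cost_le hΩcs hX.isCompact hU.isCompact h0 hθsX (NeZero.ne N)
  obtain ⟨CP, hCP0, hCP⟩ := exists_quadForm_le S.P
  obtain ⟨ρ, hρ⟩ := hX.isCompact.isBounded.exists_norm_le
  let f : (Fin p → ℝ) → (Fin p → ℝ) := fun x => S.A *ᵥ x + S.B *ᵥ (S.K *ᵥ x + c x 0)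
  have hfpred : ∀ x, f x = S.predState x (c x) 1 := fun x => by
    have h : 0 < N := NeZero.pos N
    simp only [LinearMPC.predState, h, dite_true]
    rfl
  -- Near the target, the choice `θ = θs` is feasible and has no offset cost, leaving only the `P`
  -- term.
  have hnear : ∀ x, ‖x - S.xs‖ ≤ ε → x ∈ S.feasibleRegion ∧
      S.value x ≤ CP * ‖x - S.xs‖ ^ 2 := by
    intro x hx
    rw [hθs] at hx
    have hfeas := LinearMPC.feasible_feedforward hss hΩcs hθsadm (hball _ hx).1 (hball _ hx).2
    refine ⟨⟨_, _, hfeas⟩, (LinearMPC.value_le hP hQ hR hT hfeas).trans ?_⟩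
    rw [LinearMPC.cost_feedforward hss hLyap, ← hθs, sub_self]
    simpa [quadForm] using hCP (x - S.xs)
  have hstep : ∀ x ∈ S.feasibleRegion, (∀ w, ‖w‖ ≤ ε → f x + w ∈ S.feasibleRegion) ∧
      S.value (f x) ≤ S.value x - κ * ‖x - S.xs‖ ^ 2 := by
    intro x hx
    have hm := hcθ x hx
    have hk := hkey _ _ _ hm
    have hfx := hfpred x
    obtain ⟨v, hv, hvN⟩ := S.exists_restrict_eq (c x) (θ x)
    rw [hm.value_eq]
    rw [← hv] at hfx hm ⊢
    rw [S.predState_eq x v NeZero.one_le] at hfx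
    have hfeas := fun w (hw : ‖w‖ ≤ ε) => LinearMPC.feasible_shift hss hΩcs hΩinv h0
      (hvN N le_rfl) (hball w hw).1 (hball w hw).2 hm.1
    rw [hfx]
    refine ⟨fun w hw => ⟨_, _, hfeas w hw⟩, ?_⟩
    have hfeas0 := hfeas 0 (by simpa using hε.le)
    rw [add_zero] at hfeas0
    refine (LinearMPC.value_le hP hQ hR hT hfeas0).trans
      ((LinearMPC.cost_shift hss hR hLyap (hvN N le_rfl)).trans ?_)
    linarith
  have hvalue : ∀ x ∈ S.feasibleRegion, S.value x ≤ a + b * ‖x - S.xs‖ ^ 2 := fun x hx =>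
    (hcθ x hx).value_eq.trans_le (hcost _ _ _ (hcθ x hx).1)
  refine ⟨f, fun x hx => ?_, ?_⟩
  · refine Set.Subset.antisymm ?_ ?_
    · rintro _ ⟨c', θ', h', rfl⟩
      exact h'.successor_unique hss hX.convex hU.convex hΩconvex hP hQ hR hT (hcθ x hx)
    · rintro _ rfl
      exact ⟨_, _, hcθ x hx, rfl⟩
  -- In `C`, `CP` serves the points within `ε` of the target and `a / ε ^ 2 + b` the others, where
  -- `a ≤ a / ε ^ 2 * ‖x - xs‖ ^ 2`. The bound `M` holds because successors lie in the bounded set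
  -- `𝒳`, even if the feasible region does not.
  · refine exists_isContinuousLyapunov_of_convexOn (V := S.value) (C := CP + (a / ε ^ 2 + b))
      (M := a + b * (ρ + ρ) ^ 2) hε hκ (by positivity)
      (LinearMPC.convexOn_value hX.convex hU.convex hΩconvex hP hQ hR hT
        fun x hx => ⟨_, _, hcθ x hx⟩)
      (hnear _ (by simpa using hε.le)).1 (fun x hx => (hstep x hx).1) (fun x hx => ?_)
      (fun x hx => ?_) (fun x hx => (hstep x hx).2) (fun x hx => ?_)
    · rw [(hcθ x hx).value_eq]
      have h1 := LinearMPC.le_cost hP hQ hR x (c x) (θ x)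
      have h2 := quadForm_nonneg hT (S.xs - S.Λ *ᵥ θ x)
      have h3 := hkey _ _ _ (hcθ x hx)
      linarith
    · rw [add_mul]
      by_cases hle : ‖x - S.xs‖ ≤ ε
      · exact (hnear x hle).2.trans (le_add_of_nonneg_right (by positivity))
      · push Not at hle
        refine (hvalue x hx).trans (le_trans ?_ (le_add_of_nonneg_left (by positivity)))
        have h1 : a = a / ε ^ 2 * ε ^ 2 := by field_simp
        have h2 : a / ε ^ 2 * ε ^ 2 ≤ a / ε ^ 2 * ‖x - S.xs‖ ^ 2 := by gcongr
        rw [add_mul]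
        linarith
    · have hfX : f x ∈ S.𝒳 := by
        rw [hfpred]
        exact (hcθ x hx).1.predState_mem h0 (NeZero.pos N)
      have hfD : f x ∈ S.feasibleRegion := by
        simpa using (hstep x hx).1 0 (by simpa using hε.le)
      refine (hvalue _ hfD).trans ?_
      gcongr
      exact (norm_sub_le _ _).trans (add_le_add (hρ _ hfX) (hρ _ hθsX))
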